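/- Let $A:\mathbb R^3\to\mathbb R^3$ and $V:\mathbb R^3\to\mathbb R$ satisfy $A_k,V\in L^2_{loc}(\mathbb R^3)$, and let $V$ be infinitesimally small with respect to $-\Delta$: for every $\varepsilon>0$ there is $C_\varepsilon$ such that $\|V\varphi\|\le\varepsilon\|\Delta\varphi\|+C_\varepsilon\|\varphi\|$ for all $\varphi\in C_0^\infty(\mathbb R^3)$, where $\|\cdot\|$ is the $L^2$-norm. Let $D_A=-i\nabla+A$ in the sense of distributions, let $H^1_A(\mathbb R^3)=\{\varphi\in L^2(\mathbb R^3;\mathbb C): D_A\varphi\in L^2(\mathbb R^3;\mathbb C^3)\}$, and let $H^1_{(A,A)}(\mathbb R^6)$ be the space of all $\psi\in L^2(\mathbb R^3\times\mathbb R^3;\mathbb C)$ with $D_{A,x_1}\psi,\,D_{A,x_2}\psi\in L^2$, where $D_{A,x_k}=-i\nabla_{x_k}+A(x_k)$. Define the Pekar functional on $H^1_A(\mathbb R^3)$ by $$\mathcal E^{A,V}(\varphi)=\int\big(|D_A\varphi|^2+V|\varphi|^2\big)\,dx-\int\frac{|\varphi(x)|^2|\varphi(y)|^2}{|x-y|}\,dx\,dy,\qquad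 C^{A,V}(1)=\inf\{\mathcal E^{A,V}(\varphi):\varphi\in H^1_A(\mathbb R^3),\ \|\varphi\|=1\},$$ and, for $U\in\mathbb R$, the Pekar–Tomasevich functional on $H^1_{(A,A)}(\mathbb R^6)$ by $$\mathcal E^{A,V}_U(\psi)=\sum_{k=1}^2\int\big(|D_{A,x_k}\psi|^2+V(x_k)|\psi|^2\big)\,dx_1dx_2+U\int\frac{|\psi(x_1,x_2)|^2}{|x_1-x_2|}\,dx_1dx_2-\int\frac{\rho(x_1)\rho(x_2)}{|x_1-x_2|}\,dx_1dx_2,$$ with $\rho(x)=\int(|\psi(x,y)|^2+|\psi(y,x)|^2)\,dy$ and $C^{A,V}_U=\inf\{\mathcal E^{A,V}_U(\psi):\psi\in H^1_{(A,A)}(\mathbb R^6),\ \|\psi\|=1\}$. **Theorem.** Suppose that $\mathcal E^{A,V}$ has a minimizer, i.e. there is $\varphi_0\in H^1_A(\mathbb R^3)$ with $\|\varphi_0\|=1$ and $\mathcal E^{A,V}(\varphi_0)=C^{A,V}(1)$. Then there exists $U_A>2$ such that $C^{A,V}_U<2\,C^{A,V}(1)$ for all $U$ with $2<U<U_A$.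 -/

import Mathlib

open MeasureTheory Laplacian
open scoped ContDiff NNReal

namespace Polaron

/-- Configuration space of one particle. The configuration space of two particles is the
product `R3 × R3`, with its product Lebesgue measure. -/
abbrev R3 : Type := EuclideanSpace ℝ (Fin 3)

/-- `f ∈ L²_loc(ℝ³)`. -/
def L2Loc (f : R3 → ℝ) : Prop :=
  ∀ K : Set R3, IsCompact K → MemLp f 2 (volume.restrict K)

/-- `V` is infinitesimally small with respect to `-Δ`: for every `ε > 0` there is `C` such that
`‖V φ‖ ≤ ε ‖Δ φ‖ + C ‖φ‖` for all `φ ∈ C₀^∞(ℝ³)`, with `L²`-norms. -/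
def InfinitesimallySmall (V : R3 → ℝ) : Prop :=
  ∀ ε : ℝ≥0, 0 < ε → ∃ C : ℝ≥0, ∀ φ : R3 → ℂ, ContDiff ℝ ∞ φ → HasCompactSupport φ →
    eLpNorm (fun x => (V x : ℂ) * φ x) 2 volume
      ≤ ε * eLpNorm (Δ φ) 2 volume + C * eLpNorm φ 2 volume

section MagneticDerivative

variable {E : Type*} [NormedAddCommGroup E] [NormedSpace ℝ E] [MeasureSpace E]

/-- The distribution `-i ∂_v ψ + a ψ` is represented by the `L²` function `g`. The distributional
derivative in the direction `v` is moved to the test function `η`, which changes the sign. -/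
def HasMagneticDeriv (v : E) (a : E → ℝ) (ψ g : E → ℂ) : Prop :=
  MemLp g 2 volume ∧
    ∀ η : E → ℂ, ContDiff ℝ ∞ η → HasCompactSupport η →
      ∫ x, g x * η x = ∫ x, ψ x * (Complex.I * fderiv ℝ η x v + (a x : ℂ) * η x)

open Classical in
/-- The `L²` function `-i ∂_v ψ + a ψ` (unique up to null sets), if it exists; `0` otherwise. -/
noncomputable def magneticDeriv (v : E) (a : E → ℝ) (ψ : E → ℂ) : E → ℂ :=
  if h : ∃ g, HasMagneticDeriv v a ψ g then h.choose else 0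

end MagneticDerivative

/-- The `j`-th standard unit vector of `ℝ³`. -/
noncomputable def e (j : Fin 3) : R3 := EuclideanSpace.single j 1

/-- The `j`-th component of `D_A φ = (-i∇ + A) φ`. -/
noncomputable def D (A : R3 → R3) (j : Fin 3) (φ : R3 → ℂ) : R3 → ℂ :=
  magneticDeriv (e j) (fun x => A x j) φ

/-- The `j`-th component of `D_{A,x₁} ψ`. -/
noncomputable def D₁ (A : R3 → R3) (j : Fin 3) (ψ : R3 × R3 → ℂ) : R3 × R3 → ℂ :=
  magneticDeriv (e j, (0 : R3)) (fun x => A x.1 j) ψ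

/-- The `j`-th component of `D_{A,x₂} ψ`. -/
noncomputable def D₂ (A : R3 → R3) (j : Fin 3) (ψ : R3 × R3 → ℂ) : R3 × R3 → ℂ :=
  magneticDeriv ((0 : R3), e j) (fun x => A x.2 j) ψ

/-- The magnetic Sobolev space `H¹_A(ℝ³)`. -/
def H1 (A : R3 → R3) : Set (R3 → ℂ) :=
  {φ | MemLp φ 2 volume ∧ ∀ j : Fin 3, ∃ g, HasMagneticDeriv (e j) (fun x => A x j) φ g}

/-- The magnetic Sobolev space `H¹_{(A,A)}(ℝ⁶)`. -/
def H1Pair (A : R3 → R3) : Set (R3 × R3 → ℂ) :=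
  {ψ | MemLp ψ 2 volume ∧
    (∀ j : Fin 3, ∃ g, HasMagneticDeriv (e j, (0 : R3)) (fun x => A x.1 j) ψ g) ∧
    (∀ j : Fin 3, ∃ g, HasMagneticDeriv ((0 : R3), e j) (fun x => A x.2 j) ψ g)}

/-- The Coulomb self-energy `∫∫ ρ(x) ρ(y) / |x - y| dx dy`. -/
noncomputable def coulomb (ρ : R3 → ℝ) : ℝ :=
  ∫ p : R3 × R3, ρ p.1 * ρ p.2 / ‖p.1 - p.2‖

/-- The Pekar functional `∫ (|D_A φ|² + V |φ|²) dx - ∫∫ |φ(x)|² |φ(y)|² / |x - y| dx dy`. -/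
noncomputable def pekar (A : R3 → R3) (V : R3 → ℝ) (φ : R3 → ℂ) : ℝ :=
  (∫ x, ((∑ j, ‖D A j φ x‖ ^ 2) + V x * ‖φ x‖ ^ 2)) - coulomb (fun x => ‖φ x‖ ^ 2)

/-- `φ ∈ H¹_A(ℝ³)` with `‖φ‖² = lam`. -/
def pekarDomain (A : R3 → R3) (lam : ℝ) : Set (R3 → ℂ) :=
  {φ | φ ∈ H1 A ∧ ∫ x, ‖φ x‖ ^ 2 = lam}

/-- `C^{A,V}(lam)`, the infimum of the Pekar functional over `‖φ‖² = lam`, taken in the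
extended reals. -/
noncomputable def pekarEnergy (A : R3 → R3) (V : R3 → ℝ) (lam : ℝ) : EReal :=
  ⨅ φ ∈ pekarDomain A lam, (pekar A V φ : EReal)

/-- `φ` is a minimizer of the Pekar functional subject to `‖φ‖ = 1`. -/
def IsPekarMinimizer (A : R3 → R3) (V : R3 → ℝ) (φ : R3 → ℂ) : Prop :=
  φ ∈ pekarDomain A 1 ∧ IsMinOn (pekar A V) (pekarDomain A 1) φ

/-- The density `ρ(x) = ∫ (|ψ(x,y)|² + |ψ(y,x)|²) dy` of a two-particle state. -/
noncomputable def pairDensity (ψ : R3 × R3 → ℂ) (x : R3) : ℝ :=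
  ∫ y, (‖ψ (x, y)‖ ^ 2 + ‖ψ (y, x)‖ ^ 2)

/-- The Pekar-Tomasevich functional. -/
noncomputable def pekarTomasevich (A : R3 → R3) (V : R3 → ℝ) (U : ℝ) (ψ : R3 × R3 → ℂ) : ℝ :=
  (∫ x, ((∑ j, ‖D₁ A j ψ x‖ ^ 2) + V x.1 * ‖ψ x‖ ^ 2))
    + (∫ x, ((∑ j, ‖D₂ A j ψ x‖ ^ 2) + V x.2 * ‖ψ x‖ ^ 2))
    + U * (∫ x, ‖ψ x‖ ^ 2 / ‖x.1 - x.2‖)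
    - coulomb (pairDensity ψ)

/-- `C^{A,V}_U`, the infimum of the Pekar-Tomasevich functional over `‖ψ‖ = 1`, taken in the
extended reals. -/
noncomputable def pairEnergy (A : R3 → R3) (V : R3 → ℝ) (U : ℝ) : EReal :=
  ⨅ ψ ∈ {ψ : R3 × R3 → ℂ | ψ ∈ H1Pair A ∧ ∫ x, ‖ψ x‖ ^ 2 = 1},
    (pekarTomasevich A V U ψ : EReal)

end Polaron

/-! Let φ be a Pekar minimizer, K its one-body energy and C the Coulomb self-energy of |φ|². At U =
2 the state φ ⊗ φ has energy 2K + 2C - 4C = 2(K - C), exactly twice the Pekar energy: the repulsion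
gives 2C, and the doubled density 2|φ|² gives -4C. For a fixed state the energy is affine in U, so
it suffices to find a normalized state strictly below this value at U = 2, and for that it is enough
that φ ⊗ φ is not a critical point.

Vary φ ⊗ φ in the direction h(x₁ - x₂) φ ⊗ φ with h real, even, smooth and compactly supported. The
one-particle part of the variation is found by freezing one variable y and inserting the
Euler-Lagrange equation of φ tested with h(· - y) φ (`IsPekarMinimizer.integral_energyVariation_eq`,
`IsPekarMinimizer.integral_energyVariation_relFun`). Then K cancels, and criticality would say 2P =
H + C G. Here G is the integral of h(x - y)|φ(x)|²|φ(y)|², H is the same integral with the extra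
weight 1/|x - y|, and P is the Coulomb energy with the weight h * |φ|² in one variable. If M bounds
the Coulomb potential of |φ|², then P ≤ M G, while a bump h concentrated near 0 gives H ≥ (2M + 1) G
with G > 0. Hence 2P < H + C G (`exists_even_bump_variation_pos`), and some perturbed product state
lies lower (`IsPekarMinimizer.exists_pekarTomasevich_two_lt`).

The analytic input is that M is finite and V|φ|² is integrable although A is only in L²_loc. Both
follow from `exists_lintegral_mul_sq_le`: a uniformly locally square integrable weight is integrable
against |φ|². This is a local diamagnetic Sobolev inequality averaged over all unit balls. The
diamagnetic inequality comes from the weak chain rule `IsWeakDeriv.regNorm` for a smoothed modulus,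
in which the term with A drops out. -/

set_option linter.unusedSectionVars false

namespace Polaron

/-! ### Calculus of the weak magnetic derivative. -/

section MagneticDerivativeBasics

variable {E : Type*} [NormedAddCommGroup E] [NormedSpace ℝ E] [MeasureSpace E] [BorelSpace E]
  [IsFiniteMeasureOnCompacts (volume : Measure E)]

/-- A locally square integrable function times a continuous function with compact support is
square integrable. -/
lemma memLp_mul_of_hasCompactSupport {a : E → ℝ}
    (ha : ∀ K : Set E, IsCompact K → MemLp a 2 (volume.restrict K)) {η : E → ℂ}
    (hη : Continuous η) (hs : HasCompactSupport η) :
    MemLp (fun x => (a x : ℂ) * η x) 2 volume := by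
  obtain ⟨C, hC⟩ := hη.bounded_above_of_compact_support hs
  have hK := ha _ hs.isCompact
  have hm : MeasurableSet (tsupport η) := (isClosed_tsupport η).measurableSet
  have h1 : MemLp (fun x => (a x : ℂ) * η x) 2 (volume.restrict (tsupport η)) := by
    refine (MemLp.const_mul hK C).of_le
      ((Complex.continuous_ofReal.comp_aestronglyMeasurable hK.1).mul
        hη.aestronglyMeasurable.restrict) (Filter.Eventually.of_forall fun x => ?_)
    rw [norm_mul, norm_mul, Complex.norm_real, mul_comm]
    gcongr
    exact (hC x).trans (le_abs_self C)
  rw [← memLp_indicator_iff_restrict hm] at h1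
  convert h1 using 1
  ext x
  by_cases hx : x ∈ tsupport η
  · simp [hx]
  · simp [hx, image_eq_zero_of_notMem_tsupport hx]

lemma memLp_of_hasCompactSupport {η : E → ℂ} (hη : Continuous η) (hs : HasCompactSupport η) :
    MemLp η 2 volume := hη.memLp_of_hasCompactSupport hs

lemma integrable_mul_test {ψ : E → ℂ} (hψ : MemLp ψ 2 volume) {η : E → ℂ}
    (hη : Continuous η) (hs : HasCompactSupport η) :
    Integrable (fun x => ψ x * η x) volume :=
  hψ.integrable_mul (memLp_of_hasCompactSupport hη hs)

lemma continuous_fderiv_apply_of_contDiff {F : Type*} [NormedAddCommGroup F] [NormedSpace ℝ F]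
    {η : E → F} (hη : ContDiff ℝ ∞ η) (v : E) : Continuous fun x => fderiv ℝ η x v :=
  (hη.continuous_fderiv (by simp)).clm_apply continuous_const

lemma hasCompactSupport_fderiv_apply {F : Type*} [NormedAddCommGroup F] [NormedSpace ℝ F]
    {η : E → F} (hs : HasCompactSupport η) (v : E) :
    HasCompactSupport fun x => fderiv ℝ η x v :=
  hs.fderiv_apply (𝕜 := ℝ) v

lemma integrable_mul_adjoint_test {ψ : E → ℂ} (hψ : MemLp ψ 2 volume) {a : E → ℝ}
    (ha : ∀ K : Set E, IsCompact K → MemLp a 2 (volume.restrict K)) {η : E → ℂ}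
    (hη : ContDiff ℝ ∞ η) (hs : HasCompactSupport η) (v : E) :
    Integrable (fun x => ψ x * (Complex.I * fderiv ℝ η x v + (a x : ℂ) * η x)) volume := by
  have h1 := integrable_mul_test hψ (η := fun x => Complex.I * fderiv ℝ η x v)
    (continuous_const.mul (continuous_fderiv_apply_of_contDiff hη v))
    ((hasCompactSupport_fderiv_apply hs v).mul_left)
  have h2 : Integrable (fun x => ψ x * ((a x : ℂ) * η x)) volume :=
    hψ.integrable_mul (memLp_mul_of_hasCompactSupport ha hη.continuous hs)
  exact (h1.add h2).congr (Filter.Eventually.of_forall fun x => by simp [mul_add])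

lemma HasMagneticDeriv.add {v : E} {a : E → ℝ}
    (ha : ∀ K : Set E, IsCompact K → MemLp a 2 (volume.restrict K)) {ψ ψ' g g' : E → ℂ}
    (hψ : MemLp ψ 2 volume) (hψ' : MemLp ψ' 2 volume)
    (h : HasMagneticDeriv v a ψ g) (h' : HasMagneticDeriv v a ψ' g') :
    HasMagneticDeriv v a (fun x => ψ x + ψ' x) (fun x => g x + g' x) := by
  refine ⟨h.1.add h'.1, fun η hη hs => ?_⟩
  simp only [add_mul]
  rw [integral_add (integrable_mul_test h.1 hη.continuous hs)
      (integrable_mul_test h'.1 hη.continuous hs),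
    integral_add (integrable_mul_adjoint_test hψ ha hη hs v)
      (integrable_mul_adjoint_test hψ' ha hη hs v), h.2 η hη hs, h'.2 η hη hs]

lemma HasMagneticDeriv.const_mul {v : E} {a : E → ℝ} {ψ g : E → ℂ}
    (h : HasMagneticDeriv v a ψ g) (c : ℂ) :
    HasMagneticDeriv v a (fun x => c * ψ x) (fun x => c * g x) := by
  refine ⟨h.1.const_mul c, fun η hη hs => ?_⟩
  simp only [mul_assoc, integral_const_mul, h.2 η hη hs]

lemma HasMagneticDeriv.ae_unique [FiniteDimensional ℝ E] {v : E} {a : E → ℝ} {ψ g g' : E → ℂ}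
    (h : HasMagneticDeriv v a ψ g) (h' : HasMagneticDeriv v a ψ g') : g =ᵐ[volume] g' := by
  refine ae_eq_of_integral_contDiff_smul_eq (h.1.locallyIntegrable (by norm_num))
    (h'.1.locallyIntegrable (by norm_num)) fun η hη hs => ?_
  have hη' : ContDiff ℝ ∞ (fun x => (η x : ℂ)) := Complex.ofRealCLM.contDiff.comp hη
  have hs' : HasCompactSupport (fun x => (η x : ℂ)) := hs.comp_left (g := Complex.ofReal) rfl
  have := (h.2 _ hη' hs').trans (h'.2 _ hη' hs').symm
  simpa [mul_comm] using this

lemma HasMagneticDeriv.magneticDeriv {v : E} {a : E → ℝ} {ψ : E → ℂ}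
    (h : ∃ g, HasMagneticDeriv v a ψ g) :
    HasMagneticDeriv v a ψ (magneticDeriv v a ψ) := by
  rw [Polaron.magneticDeriv, dif_pos h]
  exact h.choose_spec

lemma HasMagneticDeriv.magneticDeriv_ae_eq [FiniteDimensional ℝ E] {v : E} {a : E → ℝ}
    {ψ g : E → ℂ} (h : HasMagneticDeriv v a ψ g) : Polaron.magneticDeriv v a ψ =ᵐ[volume] g :=
  (HasMagneticDeriv.magneticDeriv ⟨g, h⟩).ae_unique h

/-- A bounded continuous multiplier preserves square integrability. -/
lemma memLp_bdd_mul {α : Type*} [MeasurableSpace α] {μ : Measure α} {p : ENNReal} {f g : α → ℂ}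
    (hg : MemLp g p μ) (hf : AEStronglyMeasurable f μ) {C : ℝ} (hC : ∀ x, ‖f x‖ ≤ C) :
    MemLp (fun x => f x * g x) p μ := by
  refine (hg.norm.const_mul C).of_le (hf.mul hg.1) (Filter.Eventually.of_forall fun x => ?_)
  rw [norm_mul, norm_mul, norm_norm]
  gcongr
  exact (hC x).trans (le_abs_self C)

/-- The Leibniz rule for a bounded smooth real multiplier. -/
lemma HasMagneticDeriv.mul_contDiff {v : E} {a : E → ℝ}
    (ha : ∀ K : Set E, IsCompact K → MemLp a 2 (volume.restrict K)) {ψ g : E → ℂ}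
    (hψ : MemLp ψ 2 volume) (h : HasMagneticDeriv v a ψ g) {f : E → ℝ} (hf : ContDiff ℝ ∞ f)
    {C : ℝ} (hC : ∀ x, |f x| ≤ C) {C' : ℝ} (hC' : ∀ x, |fderiv ℝ f x v| ≤ C') :
    HasMagneticDeriv v a (fun x => f x * ψ x)
      (fun x => f x * g x - Complex.I * (fderiv ℝ f x v : ℝ) * ψ x) := by
  have hfc : ContDiff ℝ ∞ (fun x => (f x : ℂ)) := Complex.ofRealCLM.contDiff.comp hf
  have hd : ∀ x, fderiv ℝ (fun x => (f x : ℂ)) x v = (fderiv ℝ f x v : ℝ) := fun x => by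
    have := (Complex.ofRealCLM.hasFDerivAt.comp x
      (hf.differentiable (by simp) x).hasFDerivAt).fderiv
    erw [this]; simp
  have hcd : Continuous fun x => Complex.I * ((fderiv ℝ f x v : ℝ) : ℂ) :=
    continuous_const.mul
      (Complex.continuous_ofReal.comp (continuous_fderiv_apply_of_contDiff hf v))
  have m1 : MemLp (fun x => f x * g x) 2 volume :=
    memLp_bdd_mul h.1 hfc.continuous.aestronglyMeasurable (C := C) (by simpa using hC)
  have m2 : MemLp (fun x => Complex.I * (fderiv ℝ f x v : ℝ) * ψ x) 2 volume :=
    memLp_bdd_mul hψ hcd.aestronglyMeasurable (C := C') (by simpa using hC')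
  refine ⟨m1.sub m2, fun η hη hs => ?_⟩
  -- Test the identity for ψ with f η. The product rule leaves an extra i (∂_v f) η, which is moved
  -- to the other side and becomes part of the derivative of f ψ.
  have hη' : ContDiff ℝ ∞ (fun x => f x * η x) := hfc.mul hη
  have hs' : HasCompactSupport (fun x => f x * η x) := hs.mul_left
  have key := h.2 _ hη' hs'
  have hd' : ∀ x, fderiv ℝ (fun x => f x * η x) x v
      = f x * fderiv ℝ η x v + (fderiv ℝ f x v : ℝ) * η x := fun x => by
    rw [fderiv_fun_mul (hfc.differentiable (by simp) x) (hη.differentiable (by simp) x)]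
    simp [hd, mul_comm]
  simp only [sub_mul]
  rw [integral_sub (integrable_mul_test m1 hη.continuous hs)
    (integrable_mul_test m2 hη.continuous hs)]
  have e1 : ∫ x, f x * g x * η x = ∫ x, g x * (f x * η x) := by
    congr 1; ext x; ring
  rw [e1, key, ← integral_sub (integrable_mul_adjoint_test hψ ha hη' hs' v)
    (integrable_mul_test m2 hη.continuous hs)]
  congr 1; ext x; rw [hd']; ring

end MagneticDerivativeBasics

/-! ### Product states and exchange of the two particles. -/

section Tensor

lemma memLp_two_tensor {α β : Type*} [MeasurableSpace α] [MeasurableSpace β] {μ : Measure α}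
    {ν : Measure β} [SFinite μ] [SFinite ν] {f : α → ℂ} {g : β → ℂ}
    (hf : MemLp f 2 μ) (hg : MemLp g 2 ν) :
    MemLp (fun z : α × β => f z.1 * g z.2) 2 (μ.prod ν) := by
  have hm : AEStronglyMeasurable (fun z : α × β => f z.1 * g z.2) (μ.prod ν) :=
    hf.1.comp_fst.mul hg.1.comp_snd
  rw [memLp_two_iff_integrable_sq_norm hm]
  simp only [norm_mul, mul_pow]
  exact ((memLp_two_iff_integrable_sq_norm hf.1).1 hf).mul_prod
    ((memLp_two_iff_integrable_sq_norm hg.1).1 hg)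

variable {E : Type*} [NormedAddCommGroup E] [NormedSpace ℝ E] [FiniteDimensional ℝ E]
  [MeasureSpace E] [BorelSpace E] [IsFiniteMeasureOnCompacts (volume : Measure E)]
  [SFinite (volume : Measure E)]

/-- A locally square integrable function of the first variable is locally square integrable. -/
lemma memLp_restrict_comp_fst {a : E → ℝ}
    (ha : ∀ K : Set E, IsCompact K → MemLp a 2 (volume.restrict K)) (K : Set (E × E))
    (hK : IsCompact K) : MemLp (fun z : E × E => a z.1) 2 (volume.restrict K) := by
  have h1 := hK.image continuous_fst
  have h2 := hK.image continuous_snd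
  have hsub : K ⊆ (Prod.fst '' K) ×ˢ (Prod.snd '' K) := fun z hz =>
    ⟨Set.mem_image_of_mem _ hz, Set.mem_image_of_mem _ hz⟩
  refine MemLp.mono_measure (Measure.restrict_mono hsub le_rfl) ?_
  rw [Measure.volume_eq_prod, ← Measure.prod_restrict]
  have : IsFiniteMeasure (volume.restrict (Prod.snd '' K) : Measure E) :=
    ⟨by simpa using h2.measure_lt_top⟩
  rw [memLp_two_iff_integrable_sq (ha _ h1).1.comp_fst]
  have := ((memLp_two_iff_integrable_sq (ha _ h1).1).1 (ha _ h1)).mul_prod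
    (integrable_const (μ := volume.restrict (Prod.snd '' K)) (1 : ℝ))
  simpa using this

/-- A slice of a two-particle test function is an admissible one-particle test function; Fubini then
gives the derivative of a product state. -/
lemma integral_fst_slice {v : E} {a : E → ℝ} {φ g : E → ℂ} (h : HasMagneticDeriv v a φ g)
    {η : E × E → ℂ} (hη : ContDiff ℝ ∞ η) (hs : HasCompactSupport η) (y : E) :
    ∫ x, g x * η (x, y)
      = ∫ x, φ x * (Complex.I * fderiv ℝ η (x, y) (v, 0) + (a x : ℂ) * η (x, y)) := by
  have hsm : ContDiff ℝ ∞ fun x => η (x, y) := hη.comp (contDiff_prodMk_left y)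
  have hcs : HasCompactSupport fun x => η (x, y) := by
    refine hs.comp_isClosedEmbedding (g := fun x => (x, y)) ?_
    exact Topology.IsClosedEmbedding.of_continuous_injective_isClosedMap (by fun_prop)
      (fun x x' hx => (Prod.mk.inj hx).1) (isClosedMap_prodMk_right y)
  rw [h.2 _ hsm hcs]
  congr 1; ext x
  have : HasFDerivAt (fun x => η (x, y)) ((fderiv ℝ η (x, y)).comp (.inl ℝ E E)) x :=
    HasFDerivAt.comp (f := fun x => (x, y)) x (hη.differentiable (by simp) (x, y)).hasFDerivAt
      (hasFDerivAt_prodMk_left x y)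
  simp [this.fderiv]

/-- The magnetic derivative of a product state in the first variable. -/
lemma HasMagneticDeriv.tensor {v : E} {a : E → ℝ}
    (ha : ∀ K : Set E, IsCompact K → MemLp a 2 (volume.restrict K)) {φ g χ : E → ℂ}
    (hφ : MemLp φ 2 volume) (h : HasMagneticDeriv v a φ g) (hχ : MemLp χ 2 volume) :
    HasMagneticDeriv (v, (0 : E)) (fun z : E × E => a z.1) (fun z => φ z.1 * χ z.2)
      (fun z => g z.1 * χ z.2) := by
  have mg : MemLp (fun z : E × E => g z.1 * χ z.2) 2 volume := memLp_two_tensor h.1 hχ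
  have mφ : MemLp (fun z : E × E => φ z.1 * χ z.2) 2 volume := memLp_two_tensor hφ hχ
  refine ⟨mg, fun η hη hs => ?_⟩
  have i1 := integrable_mul_test mg hη.continuous hs
  have i2 := integrable_mul_adjoint_test mφ (memLp_restrict_comp_fst ha) hη hs (v, 0)
  rw [Measure.volume_eq_prod] at i1 i2 ⊢
  rw [integral_prod_symm _ i1, integral_prod_symm _ i2]
  congr 1; ext y
  have e1 : ∀ x, g x * χ y * η (x, y) = χ y * (g x * η (x, y)) := fun x => by ring
  have e2 : ∀ x, φ x * χ y * (Complex.I * fderiv ℝ η (x, y) (v, 0) + (a x : ℂ) * η (x, y))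
      = χ y * (φ x * (Complex.I * fderiv ℝ η (x, y) (v, 0) + (a x : ℂ) * η (x, y))) :=
    fun x => by ring
  simp only [e1, e2, integral_const_mul, integral_fst_slice h hη hs y]

/-- Exchange of the two variables. -/
lemma HasMagneticDeriv.swap {v : E} {a : E → ℝ} {ψ g : E × E → ℂ}
    (h : HasMagneticDeriv (v, (0 : E)) (fun z : E × E => a z.1) ψ g) :
    HasMagneticDeriv ((0 : E), v) (fun z : E × E => a z.2) (fun z => ψ z.swap)
      (fun z => g z.swap) := by
  have mp : MeasurePreserving (Prod.swap : E × E → E × E) volume volume :=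
    Measure.measurePreserving_swap
  have emb : MeasurableEmbedding (Prod.swap : E × E → E × E) :=
    MeasurableEquiv.prodComm.measurableEmbedding
  refine ⟨h.1.comp_measurePreserving mp, fun η hη hs => ?_⟩
  let L : (E × E) ≃L[ℝ] (E × E) := ContinuousLinearEquiv.prodComm ℝ E E
  have hη' : ContDiff ℝ ∞ (fun z : E × E => η z.swap) := hη.comp L.contDiff
  have hs' : HasCompactSupport (fun z : E × E => η z.swap) :=
    hs.comp_homeomorph L.toHomeomorph
  have key := h.2 _ hη' hs'
  have hd : ∀ z : E × E, fderiv ℝ (fun z : E × E => η z.swap) z (v, 0)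
      = fderiv ℝ η z.swap (0, v) := fun z => by
    have := ((hη.differentiable (by simp) (L z)).hasFDerivAt.comp z
      L.hasFDerivAt).fderiv
    erw [this]
    rfl
  rw [← mp.integral_comp emb, ← mp.integral_comp emb (fun z => ψ z.swap * _)]
  simpa [hd] using key

end Tensor

/-! ### Mollification: almost everywhere and L¹ convergence, Young's inequality. -/

section Mollifier

open Filter Topology ContinuousLinearMap
open scoped ENNReal

variable {E : Type*} [NormedAddCommGroup E] [NormedSpace ℝ E] [FiniteDimensional ℝ E]
  [MeasureSpace E] [BorelSpace E] [(volume : Measure E).IsAddHaarMeasure]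
  {F : Type*} [NormedAddCommGroup F] [NormedSpace ℝ F] [CompleteSpace F]

/-- Bump functions at the origin with radii `1 / (k + 1)` and `2 / (k + 1)`. -/
noncomputable def shrinkingBump (E : Type*) [NormedAddCommGroup E] (k : ℕ) :
    ContDiffBump (0 : E) where
  rIn := 1 / (k + 1)
  rOut := 2 / (k + 1)
  rIn_pos := by positivity
  rIn_lt_rOut := by gcongr; norm_num

/-- Convolution with the normalized `k`-th shrinking bump function. -/
noncomputable def mollify (k : ℕ) (g : E → F) : E → F :=
  convolution ((shrinkingBump E k).normed volume) g (lsmul ℝ ℝ) volume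

/-- The kernel of `mollify`. -/
noncomputable def mollifier (E : Type*) [NormedAddCommGroup E] [NormedSpace ℝ E]
    [FiniteDimensional ℝ E] [MeasureSpace E] (k : ℕ) : E → ℝ :=
  (shrinkingBump E k).normed volume

lemma mollifier_nonneg (k : ℕ) (x : E) : 0 ≤ mollifier E k x :=
  (shrinkingBump E k).nonneg_normed x

lemma contDiff_mollifier (k : ℕ) : ContDiff ℝ ∞ (mollifier E k) :=
  (shrinkingBump E k).contDiff_normed

lemma hasCompactSupport_mollifier (k : ℕ) : HasCompactSupport (mollifier E k) :=
  (shrinkingBump E k).hasCompactSupport_normed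

lemma mollify_apply (k : ℕ) (g : E → F) (x : E) :
    mollify k g x = ∫ y, mollifier E k (x - y) • g y := by
  rw [mollify, convolution_eq_swap]
  rfl

lemma tendsto_shrinkingBump_rOut : Tendsto (fun k => (shrinkingBump E k).rOut) atTop (𝓝 0) := by
  have := (tendsto_one_div_add_atTop_nhds_zero_nat (𝕜 := ℝ)).const_mul 2
  simpa [shrinkingBump, div_eq_mul_inv] using this

lemma ae_tendsto_mollify {g : E → F} (hg : LocallyIntegrable g volume) :
    ∀ᵐ x, Tendsto (fun k => mollify k g x) atTop (𝓝 (g x)) := by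
  -- The outer radius is exactly twice the inner one, so the kernels are comparable to averages over
  -- balls and Lebesgue differentiation applies.
  refine ContDiffBump.ae_convolution_tendsto_right_of_locallyIntegrable (K := 2)
    tendsto_shrinkingBump_rOut (Eventually.of_forall fun k => ?_) hg
  simp only [shrinkingBump]
  apply le_of_eq; ring

lemma contDiff_mollify (k : ℕ) {g : E → F} (hg : LocallyIntegrable g volume) :
    ContDiff ℝ ∞ (mollify k g) :=
  (hasCompactSupport_mollifier k).contDiff_convolution_left (n := ⊤) (lsmul ℝ ℝ)
    (contDiff_mollifier k) hg

lemma hasCompactSupport_mollify (k : ℕ) {g : E → F} (hg : HasCompactSupport g) :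
    HasCompactSupport (mollify k g) :=
  (hasCompactSupport_mollifier k).convolution _ hg

lemma fderiv_mollify (k : ℕ) {g : E → F} (hg : LocallyIntegrable g volume) (x v : E) :
    fderiv ℝ (mollify k g) x v = ∫ y, (fderiv ℝ (mollifier E k) (x - y) v) • g y := by
  have hint := ((hasCompactSupport_mollifier (E := E) k).fderiv ℝ).convolutionExists_left
    (μ := volume) (precompL E (lsmul ℝ ℝ : ℝ →L[ℝ] F →L[ℝ] F))
    ((contDiff_mollifier k).continuous_fderiv (by simp)) hg x
  have := (hasCompactSupport_mollifier (E := E) k).hasFDerivAt_convolution_left (lsmul ℝ ℝ)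
    ((contDiff_mollifier k).of_le (by simp)) hg x
  have h2 : fderiv ℝ (mollify k g) x = _ := this.fderiv
  rw [h2, convolution_eq_swap, ContinuousLinearMap.integral_apply]
  · simp [precompL_apply]
  · exact hint.integrable_swap

lemma lintegral_mollifier (k : ℕ) : ∫⁻ x, ENNReal.ofReal (mollifier E k x) = 1 := by
  rw [← ofReal_integral_eq_lintegral_ofReal]
  · simp [mollifier, ContDiffBump.integral_normed]
  · exact (contDiff_mollifier k).continuous.integrable_of_hasCompactSupport
      (hasCompactSupport_mollifier k)
  · exact Eventually.of_forall fun x => mollifier_nonneg k x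

/-- Young's inequality for mollification. -/
lemma lintegral_enorm_mollify_rpow_le (k : ℕ) {p : ℝ} (hp : 1 ≤ p) {g : E → F}
    (hg : AEStronglyMeasurable g volume) :
    ∫⁻ x, ‖mollify k g x‖ₑ ^ p ≤ ∫⁻ x, ‖g x‖ₑ ^ p := by
  have hp0 : 0 < p := by linarith
  have hmeas : Measurable fun x : E => ENNReal.ofReal (mollifier E k x) :=
    (contDiff_mollifier k).continuous.measurable.ennreal_ofReal
  have pointwise : ∀ x, ‖mollify k g x‖ₑ ^ p
      ≤ ∫⁻ y, ENNReal.ofReal (mollifier E k (x - y)) * ‖g y‖ₑ ^ p := by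
    intro x
    have hmx : Measurable fun y : E => ENNReal.ofReal (mollifier E k (x - y)) :=
      hmeas.comp (measurable_const.sub measurable_id)
    -- The mollified value at x is a mean of g over this probability measure, so monotonicity of the
    -- mean norms in the exponent (Jensen) gives the pointwise bound; Tonelli then finishes.
    set ν := (volume : Measure E).withDensity fun y => ENNReal.ofReal (mollifier E k (x - y))
    have hν : IsProbabilityMeasure ν := ⟨by
      rw [withDensity_apply _ MeasurableSet.univ, Measure.restrict_univ,
        lintegral_sub_left_eq_self (fun y : E => ENNReal.ofReal (mollifier E k y)) x,
        lintegral_mollifier]⟩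
    have hac : ν ≪ volume := withDensity_absolutelyContinuous _ _
    have h1 : ‖mollify k g x‖ₑ ≤ ∫⁻ y, ‖g y‖ₑ ∂ν := by
      rw [mollify_apply, lintegral_withDensity_eq_lintegral_mul₀ hmx.aemeasurable hg.enorm]
      refine (enorm_integral_le_lintegral_enorm _).trans (le_of_eq ?_)
      congr 1; ext y
      rw [enorm_smul, Pi.mul_apply, Real.enorm_of_nonneg (mollifier_nonneg k _)]
    have h2 := eLpNorm'_le_eLpNorm'_of_exponent_le one_pos hp ν (hg.mono_ac hac)
    simp only [eLpNorm', ENNReal.rpow_one, div_one] at h2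
    have h3 := ENNReal.rpow_le_rpow (h1.trans h2) hp0.le
    rw [← ENNReal.rpow_mul, one_div, inv_mul_cancel₀ hp0.ne', ENNReal.rpow_one,
      lintegral_withDensity_eq_lintegral_mul₀ hmx.aemeasurable (hg.enorm.pow_const p)] at h3
    exact h3
  refine (lintegral_mono pointwise).trans ?_
  rw [lintegral_lintegral_swap]
  · refine le_of_eq ?_
    congr 1; ext y
    have hmy : Measurable fun x : E => ENNReal.ofReal (mollifier E k (x - y)) :=
      hmeas.comp (measurable_id.sub measurable_const)
    rw [lintegral_mul_const _ hmy,
      lintegral_sub_right_eq_self (fun x : E => ENNReal.ofReal (mollifier E k x)) y,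
      lintegral_mollifier, one_mul]
  · exact (hmeas.comp (measurable_fst.sub measurable_snd)).aemeasurable.mul
      (hg.comp_snd.enorm.pow_const p)

/-- Mollification of an integrable function converges in `L¹`. -/
lemma tendsto_lintegral_mollify_sub {g : E → F} (hg : Integrable g volume) :
    Tendsto (fun k => ∫⁻ x, ‖mollify k g x - g x‖ₑ) atTop (𝓝 0) := by
  -- For such c, uniform continuity controls the error on the 2-thickening of the support, and
  -- outside it the error vanishes since all kernel radii are at most 2. General g follows by
  -- density, with Young's inequality for p = 1 bounding the mollified remainder.
  have hcont : ∀ c : E → F, Continuous c → HasCompactSupport c →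
      Tendsto (fun k => ∫⁻ x, ‖mollify k c x - c x‖ₑ) atTop (𝓝 0) := by
    intro c hc hs
    set K := Metric.cthickening 2 (tsupport c)
    have hK : IsCompact K := hs.isCompact.cthickening
    have hvol : volume K ≠ ⊤ := hK.measure_lt_top.ne
    have hout : ∀ k, ∀ x ∉ K, mollify k c x - c x = 0 := by
      intro k x hx
      have hr : (shrinkingBump E k).rOut ≤ 2 := by
        simp only [shrinkingBump]
        exact div_le_self (by norm_num) (by linarith [(Nat.cast_nonneg k : (0 : ℝ) ≤ k)])
      have hz : ∀ y ∈ Metric.ball x 2, c y = 0 := fun y hy => by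
        by_contra hne
        refine hx (Metric.mem_cthickening_of_dist_le x y 2 _
          (subset_tsupport c hne) ?_)
        rw [dist_comm]; exact (Metric.mem_ball.1 hy).le
      have := (shrinkingBump E k).dist_normed_convolution_le (μ := volume) (x₀ := x) (ε := 0)
        hc.aestronglyMeasurable (g := c) (fun y hy => by
          rw [hz y (Metric.ball_subset_ball hr hy), hz x (Metric.mem_ball_self two_pos)]; simp)
      rw [dist_le_zero] at this
      rw [sub_eq_zero]; exact this
    rw [ENNReal.tendsto_nhds_zero]
    intro ε hε
    obtain ⟨δ, hδ, hδε⟩ : ∃ δ : ℝ≥0, 0 < δ ∧ δ * volume K ≤ ε := by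
      rcases eq_or_ne ε ⊤ with rfl | hε'
      · exact ⟨1, one_pos, le_top⟩
      obtain ⟨δ, hδ, h⟩ := ENNReal.exists_nnreal_pos_mul_lt hvol hε.ne'
      exact ⟨δ, hδ, h.le⟩
    obtain ⟨r, hr, hrc⟩ := Metric.uniformContinuous_iff.1
      (hs.uniformContinuous_of_continuous hc) δ hδ
    filter_upwards [(tendsto_order.1 (tendsto_shrinkingBump_rOut (E := E))).2 r hr] with k hk
    refine le_trans ?_ hδε
    have : ∫⁻ x, ‖mollify k c x - c x‖ₑ ≤ ∫⁻ x in K, (δ : ℝ≥0∞) := by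
      rw [← lintegral_indicator hK.isClosed.measurableSet]
      refine lintegral_mono fun x => ?_
      by_cases hx : x ∈ K
      · rw [Set.indicator_of_mem hx]
        have := (shrinkingBump E k).dist_normed_convolution_le (μ := volume) (x₀ := x) (ε := δ)
          hc.aestronglyMeasurable (g := c) (fun y hy => (hrc ((Metric.mem_ball.1 hy).trans hk)).le)
        rw [dist_eq_norm] at this
        rw [enorm_le_coe]
        exact this
      · rw [Set.indicator_of_notMem hx, hout k x hx]; simp
    simpa using this
  rw [ENNReal.tendsto_nhds_zero]
  intro ε hε
  have hε3 : ε / 3 ≠ 0 := by simpa using hε.ne'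
  obtain ⟨c, hcs, hcε, hcc, hci⟩ := hg.exists_hasCompactSupport_lintegral_sub_le hε3
  filter_upwards [ENNReal.tendsto_nhds_zero.1 (hcont c hcc hcs) (ε / 3)
    (pos_iff_ne_zero.2 hε3)] with k hk
  have hsplit : ∀ x, mollify k g x - g x
      = mollify k (g - c) x + (mollify k c x - c x) + (c x - g x) := by
    intro x
    have e1 : ConvolutionExists ((shrinkingBump E k).normed volume) (g - c) (lsmul ℝ ℝ) volume :=
      (hasCompactSupport_mollifier k).convolutionExists_left _ (contDiff_mollifier k).continuous
        (hg.sub hci).locallyIntegrable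
    have e2 : ConvolutionExists ((shrinkingBump E k).normed volume) c (lsmul ℝ ℝ) volume :=
      (hasCompactSupport_mollifier k).convolutionExists_left _ (contDiff_mollifier k).continuous
        hci.locallyIntegrable
    have := congrFun (e1.distrib_add e2) x
    rw [sub_add_cancel] at this
    rw [mollify, this]
    simp only [mollify, Pi.add_apply]
    abel
  have hm1 : AEMeasurable (fun x => ‖mollify k (g - c) x‖ₑ) volume :=
    (contDiff_mollify k (hg.sub hci).locallyIntegrable).continuous.aestronglyMeasurable.enorm
  have hm2 : AEMeasurable (fun x => ‖mollify k c x - c x‖ₑ) volume :=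
    ((contDiff_mollify k hci.locallyIntegrable).continuous.sub hcc).aestronglyMeasurable.enorm
  calc ∫⁻ x, ‖mollify k g x - g x‖ₑ
      ≤ ∫⁻ x, (‖mollify k (g - c) x‖ₑ + ‖mollify k c x - c x‖ₑ + ‖c x - g x‖ₑ) := by
        refine lintegral_mono fun x => ?_
        rw [hsplit x]
        exact (enorm_add_le _ _).trans (add_le_add (enorm_add_le _ _) le_rfl)
    _ = (∫⁻ x, ‖mollify k (g - c) x‖ₑ) + (∫⁻ x, ‖mollify k c x - c x‖ₑ)
          + ∫⁻ x, ‖c x - g x‖ₑ := by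
        have hm12 : AEMeasurable (fun x => ‖mollify k (g - c) x‖ₑ + ‖mollify k c x - c x‖ₑ)
          volume := hm1.add hm2
        rw [lintegral_add_left' hm12, lintegral_add_left' hm1]
    _ ≤ ε / 3 + ε / 3 + ε / 3 := by
        gcongr
        · have := lintegral_enorm_mollify_rpow_le k le_rfl (hg.sub hci).1
          simp only [ENNReal.rpow_one] at this
          exact this.trans hcε
        · simpa only [enorm_sub_rev] using hcε
    _ = ε := ENNReal.add_thirds ε

end Mollifier

/-! ### Weak derivatives and the chain rule for a smoothed modulus. -/

section WeakDerivative

open Filter Topology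
open scoped ENNReal

variable {E : Type*} [NormedAddCommGroup E] [NormedSpace ℝ E] [FiniteDimensional ℝ E]
  [MeasureSpace E] [BorelSpace E] [(volume : Measure E).IsAddHaarMeasure]
  {F : Type*} [NormedAddCommGroup F] [InnerProductSpace ℝ F] [CompleteSpace F]

/-- `G` is the weak derivative of `f` in the direction `v`. -/
def IsWeakDeriv (v : E) (f G : E → F) : Prop :=
  ∀ η : E → ℝ, ContDiff ℝ ∞ η → HasCompactSupport η →
    ∫ x, fderiv ℝ η x v • f x = -∫ x, η x • G x

/-- The reflected kernel y ↦ `mollifier E k (x - y)` is itself a test function; the sign from the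
reflection cancels the sign in the weak identity. -/
lemma IsWeakDeriv.fderiv_mollify {v : E} {f G : E → F} (h : IsWeakDeriv v f G)
    (hf : LocallyIntegrable f volume) (k : ℕ) (x : E) :
    fderiv ℝ (mollify k f) x v = mollify k G x := by
  rw [Polaron.fderiv_mollify k hf, mollify_apply]
  have hη : ContDiff ℝ ∞ fun y => mollifier E k (x - y) :=
    (contDiff_mollifier k).comp (contDiff_const.sub contDiff_id)
  have hs : HasCompactSupport fun y => mollifier E k (x - y) :=
    (hasCompactSupport_mollifier k).comp_homeomorph (Homeomorph.subLeft x)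
  have hd : ∀ y, fderiv ℝ (fun y => mollifier E k (x - y)) y v
      = -(fderiv ℝ (mollifier E k) (x - y) v) := fun y => by
    have h1 : HasFDerivAt (fun y : E => x - y) (-ContinuousLinearMap.id ℝ E) y :=
      (hasFDerivAt_id y).const_sub x
    have := HasFDerivAt.comp (f := fun y : E => x - y) y
      ((contDiff_mollifier k).differentiable (by simp) (x - y)).hasFDerivAt h1
    erw [this.fderiv]
    simp
  have key := h _ hη hs
  simp only [hd, neg_smul, integral_neg] at key
  exact neg_injective key

/-- A smooth approximation of the norm, vanishing at the origin. -/
noncomputable def regNorm (κ : ℝ) (z : F) : ℝ := √(‖z‖ ^ 2 + κ ^ 2) - κ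

/-- The gradient of `regNorm`. -/
noncomputable def regDir (κ : ℝ) (z : F) : F := (√(‖z‖ ^ 2 + κ ^ 2))⁻¹ • z

lemma norm_regDir_le (κ : ℝ) (z : F) : ‖regDir κ z‖ ≤ 1 := by
  rw [regDir, norm_smul, norm_inv, Real.norm_of_nonneg (Real.sqrt_nonneg _)]
  refine inv_mul_le_one_of_le₀ ?_ (Real.sqrt_nonneg _)
  exact Real.le_sqrt_of_sq_le (by nlinarith [sq_nonneg κ])

/-- The Lipschitz constant 1, uniform in κ, transfers L¹ convergence of functions to their
regularized norms. -/
lemma abs_regNorm_sub_le (κ : ℝ) (z w : F) : |regNorm κ z - regNorm κ w| ≤ ‖z - w‖ := by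
  have aux : ∀ z w : F, √(‖z‖ ^ 2 + κ ^ 2) ≤ √(‖w‖ ^ 2 + κ ^ 2) + ‖z - w‖ := by
    intro z w
    have h0 : ‖w‖ ≤ √(‖w‖ ^ 2 + κ ^ 2) := Real.le_sqrt_of_sq_le (by nlinarith [sq_nonneg κ])
    have h1 : ‖z‖ ≤ ‖w‖ + ‖z - w‖ := norm_le_norm_add_norm_sub' z w
    rw [Real.sqrt_le_iff]
    refine ⟨by positivity, ?_⟩
    have h2 := Real.sq_sqrt (show 0 ≤ ‖w‖ ^ 2 + κ ^ 2 by positivity)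
    nlinarith [norm_nonneg z, norm_nonneg w, norm_nonneg (z - w),
      mul_le_mul_of_nonneg_right h0 (norm_nonneg (z - w))]
  rw [abs_le, regNorm, regNorm]
  have h1 := aux z w
  have h2 := aux w z
  rw [norm_sub_rev] at h2
  constructor <;> linarith

lemma regNorm_zero {κ : ℝ} (hκ : 0 ≤ κ) : regNorm κ (0 : F) = 0 := by
  simp [regNorm, Real.sqrt_sq hκ]

lemma abs_regNorm_le {κ : ℝ} (hκ : 0 ≤ κ) (z : F) : |regNorm κ z| ≤ ‖z‖ := by
  simpa [regNorm_zero hκ] using abs_regNorm_sub_le κ z 0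

lemma contDiff_regNorm {κ : ℝ} (hκ : 0 < κ) : ContDiff ℝ ∞ (regNorm κ : F → ℝ) :=
  (((contDiff_norm_sq ℝ).add contDiff_const).sqrt fun z => by positivity).sub contDiff_const

lemma continuous_regDir {κ : ℝ} (hκ : 0 < κ) : Continuous (regDir κ : F → F) := by
  unfold regDir
  refine Continuous.smul (Continuous.inv₀ (by fun_prop) fun z => ?_) continuous_id
  positivity

lemma fderiv_regNorm_comp {κ : ℝ} (hκ : 0 < κ) {f : E → F} {x : E} (hf : DifferentiableAt ℝ f x)
    (v : E) :
    fderiv ℝ (fun y => regNorm κ (f y)) x v = inner ℝ (regDir κ (f x)) (fderiv ℝ f x v) := by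
  have h : HasFDerivAt (fun y => regNorm κ (f y)) _ x :=
    ((hf.hasFDerivAt.norm_sq.add_const (κ ^ 2)).sqrt (by positivity)).sub_const κ
  rw [h.fderiv]
  simp only [regDir, inner_smul_left, _root_.smul_apply,
    ContinuousLinearMap.comp_apply, innerSL_apply_apply, smul_eq_mul, nsmul_eq_mul]
  simp only [RCLike.conj_to_real]
  field_simp
  norm_num

/-- The weak chain rule for the regularized norm. -/
lemma IsWeakDeriv.regNorm {κ : ℝ} (hκ : 0 < κ) {v : E} {f G : E → F} (h : IsWeakDeriv v f G)
    (hf : Integrable f volume) (hG : Integrable G volume) :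
    IsWeakDeriv v (fun x => Polaron.regNorm κ (f x))
      (fun x => inner ℝ (regDir κ (f x)) (G x)) := by
  intro η hη hs
  have hdc := continuous_fderiv_apply_of_contDiff hη v
  have hds := hasCompactSupport_fderiv_apply hs v
  obtain ⟨C, hC⟩ := hη.continuous.bounded_above_of_compact_support hs
  obtain ⟨C', hC'⟩ := hdc.bounded_above_of_compact_support hds
  have hC0 : 0 ≤ C := (norm_nonneg _).trans (hC 0)
  have hC0' : 0 ≤ C' := (norm_nonneg _).trans (hC' 0)
  have hfk := fun k => contDiff_mollify k hf.locallyIntegrable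
  have hGk := fun k => contDiff_mollify k hG.locallyIntegrable
  have huk : ∀ k, ContDiff ℝ ∞ fun x => Polaron.regNorm κ (mollify k f x) :=
    fun k => (contDiff_regNorm hκ).comp (hfk k)
  have hdk : ∀ k x, fderiv ℝ (fun x => Polaron.regNorm κ (mollify k f x)) x v
      = inner ℝ (regDir κ (mollify k f x)) (mollify k G x) := fun k x => by
    rw [fderiv_regNorm_comp hκ ((hfk k).differentiable (by simp) x),
      h.fderiv_mollify hf.locallyIntegrable]
  have hcwk : ∀ k, Continuous fun x =>
      (inner ℝ (regDir κ (mollify k f x)) (mollify k G x) : ℝ) := fun k =>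
    ((continuous_regDir hκ).comp (hfk k).continuous).inner (hGk k).continuous
  -- For the mollified function the chain rule is classical; it remains to let k → ∞ on both sides.
  have ibp : ∀ k, ∫ x, fderiv ℝ η x v * Polaron.regNorm κ (mollify k f x)
      = -∫ x, η x * inner ℝ (regDir κ (mollify k f x)) (mollify k G x) := by
    intro k
    have i1 : Integrable (fun x => fderiv ℝ η x v * Polaron.regNorm κ (mollify k f x)) volume :=
      (hdc.mul (huk k).continuous).integrable_of_hasCompactSupport hds.mul_right
    have i2 : Integrable (fun x => η x *
        fderiv ℝ (fun x => Polaron.regNorm κ (mollify k f x)) x v) volume :=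
      (hη.continuous.mul (continuous_fderiv_apply_of_contDiff (huk k)
        v)).integrable_of_hasCompactSupport hs.mul_right
    have i3 : Integrable (fun x => η x * Polaron.regNorm κ (mollify k f x)) volume :=
      (hη.continuous.mul (huk k).continuous).integrable_of_hasCompactSupport hs.mul_right
    have := integral_mul_fderiv_eq_neg_fderiv_mul_of_integrable i1 i2 i3
      (fun x _ => hη.differentiable (by simp) x)
      (fun x _ => (huk k).differentiable (by simp) x)
    simp only [hdk] at this
    rw [this, neg_neg]
  have cf := tendsto_lintegral_mollify_sub hf
  have cG := tendsto_lintegral_mollify_sub hG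
  have t1 : Tendsto (fun k => ∫ x, fderiv ℝ η x v * Polaron.regNorm κ (mollify k f x)) atTop
      (𝓝 (∫ x, fderiv ℝ η x v * Polaron.regNorm κ (f x))) := by
    refine tendsto_integral_of_L1
      (fun x => fderiv ℝ η x v * Polaron.regNorm κ (f x)) (hdc.aestronglyMeasurable.mul
      ((contDiff_regNorm hκ).continuous.comp_aestronglyMeasurable hf.1))
      (Eventually.of_forall fun k =>
        (hdc.mul (huk k).continuous).integrable_of_hasCompactSupport hds.mul_right) ?_
    have := ENNReal.Tendsto.const_mul (a := ENNReal.ofReal C') cf (Or.inr ENNReal.ofReal_ne_top)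
    rw [mul_zero] at this
    refine tendsto_of_tendsto_of_tendsto_of_le_of_le tendsto_const_nhds this
      (fun k => zero_le) (fun k => ?_)
    dsimp only
    rw [← lintegral_const_mul' _ _ ENNReal.ofReal_ne_top]
    refine lintegral_mono fun x => ?_
    rw [← mul_sub, enorm_mul]
    gcongr
    · rw [← ofReal_norm]; exact ENNReal.ofReal_le_ofReal (hC' x)
    · rw [enorm_le_iff_norm_le]; exact abs_regNorm_sub_le κ _ _
  have hmdir : AEStronglyMeasurable (fun x => regDir κ (f x)) volume :=
    (continuous_regDir hκ).comp_aestronglyMeasurable hf.1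
  have t2 : Tendsto (fun k => ∫ x, η x * inner ℝ (regDir κ (mollify k f x)) (mollify k G x)) atTop
      (𝓝 (∫ x, η x * inner ℝ (regDir κ (f x)) (G x))) := by
    refine tendsto_integral_of_L1
      (fun x => η x * inner ℝ (regDir κ (f x)) (G x)) (hη.continuous.aestronglyMeasurable.mul
      (hmdir.inner hG.1)) (Eventually.of_forall fun k =>
        (hη.continuous.mul (hcwk k)).integrable_of_hasCompactSupport hs.mul_right) ?_
    -- The directions are only known to converge almost everywhere, but they have norm at most 1, so
    -- 2‖G‖ is an integrable majorant.
    have cdir : Tendsto (fun k => ∫⁻ x, ‖regDir κ (mollify k f x) - regDir κ (f x)‖ₑ * ‖G x‖ₑ)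
        atTop (𝓝 0) := by
      have := tendsto_lintegral_of_dominated_convergence' (μ := (volume : Measure E))
        (F := fun k x => ‖regDir κ (mollify k f x) - regDir κ (f x)‖ₑ * ‖G x‖ₑ)
        (f := fun _ => 0) (fun x => 2 * ‖G x‖ₑ)
        (fun k => ((((continuous_regDir hκ).comp (hfk k).continuous).aestronglyMeasurable.sub
          hmdir).enorm.mul hG.1.enorm))
        (fun k => Eventually.of_forall fun x => ?_) ?_ ?_
      · simpa using this
      · dsimp only
        gcongr
        refine (enorm_sub_le).trans ?_
        have aux : ∀ z : F, ‖regDir κ z‖ₑ ≤ 1 := fun z => by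
          rw [← enorm_one (G := ℝ), enorm_le_iff_norm_le, norm_one]; exact norm_regDir_le κ z
        calc _ ≤ (1 : ℝ≥0∞) + 1 := add_le_add (aux _) (aux _)
          _ = 2 := one_add_one_eq_two
      · rw [lintegral_const_mul' _ _ (by simp)]
        exact ENNReal.mul_ne_top (by simp) hG.2.ne
      · filter_upwards [ae_tendsto_mollify hf.locallyIntegrable] with x hx
        have h1 : Tendsto (fun k => regDir κ (mollify k f x) - regDir κ (f x)) atTop (𝓝 0) := by
          rw [← sub_self (regDir κ (f x))]
          exact (((continuous_regDir hκ).tendsto (f x)).comp hx).sub_const _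
        have h2 := ENNReal.Tendsto.mul_const (b := ‖G x‖ₑ) h1.enorm (Or.inr enorm_ne_top)
        simpa using h2
    have := ENNReal.Tendsto.const_mul (a := ENNReal.ofReal C) (cG.add cdir)
      (Or.inr ENNReal.ofReal_ne_top)
    rw [add_zero, mul_zero] at this
    refine tendsto_of_tendsto_of_tendsto_of_le_of_le tendsto_const_nhds this
      (fun k => zero_le) (fun k => ?_)
    dsimp only
    have hm : AEMeasurable (fun x => ‖mollify k G x - G x‖ₑ) volume :=
      ((hGk k).continuous.aestronglyMeasurable.sub hG.1).enorm
    rw [← lintegral_add_left' hm,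
      ← lintegral_const_mul' _ _ ENNReal.ofReal_ne_top]
    refine lintegral_mono fun x => ?_
    rw [← mul_sub, enorm_mul]
    gcongr
    · rw [← ofReal_norm]; exact ENNReal.ofReal_le_ofReal (hC x)
    · have e : (inner ℝ (regDir κ (mollify k f x)) (mollify k G x) : ℝ)
          - inner ℝ (regDir κ (f x)) (G x)
          = inner ℝ (regDir κ (mollify k f x)) (mollify k G x - G x)
            + inner ℝ (regDir κ (mollify k f x) - regDir κ (f x)) (G x) := by
        rw [inner_sub_right, inner_sub_left]; ring
      rw [e]
      refine (enorm_add_le _ _).trans (add_le_add ?_ ?_)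
      · rw [enorm_le_iff_norm_le]
        refine (norm_inner_le_norm _ _).trans ?_
        exact mul_le_of_le_one_left (norm_nonneg _) (norm_regDir_le κ _)
      · rw [← ofReal_norm, ← ofReal_norm, ← ofReal_norm,
          ← ENNReal.ofReal_mul (norm_nonneg _)]
        exact ENNReal.ofReal_le_ofReal (norm_inner_le_norm _ _)
  have t1' := t1
  simp only [ibp] at t1'
  exact tendsto_nhds_unique t1' t2.neg

end WeakDerivative

/-! ### The diamagnetic Sobolev inequality for compact support. -/

section Sobolev

open Filter Topology
open scoped ENNReal

lemma integrable_of_memLp_of_hasCompactSupport {E : Type*} [TopologicalSpace E] [MeasureSpace E]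
    [BorelSpace E] [IsFiniteMeasureOnCompacts (volume : Measure E)] {f : E → ℂ}
    (hf : MemLp f 2 volume) (hs : HasCompactSupport f) : Integrable f volume := by
  have : IsFiniteMeasure (volume.restrict (tsupport f)) :=
    ⟨by simpa using hs.isCompact.measure_lt_top⟩
  rw [← integrableOn_iff_integrable_of_support_subset (subset_tsupport f)]
  exact (hf.restrict (tsupport f)).integrable (by norm_num)

/-- With a only in L²_loc and f in L², the product a f is in general merely L¹. This is why the weak
chain rule works with integrable functions. -/
lemma integrable_potential_mul {E : Type*} [TopologicalSpace E] [MeasureSpace E]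
    [BorelSpace E] {a : E → ℝ}
    (ha : ∀ K : Set E, IsCompact K → MemLp a 2 (volume.restrict K)) {f : E → ℂ}
    (hf : MemLp f 2 volume) (hs : HasCompactSupport f) :
    Integrable (fun x => (a x : ℂ) * f x) volume := by
  have hsub : Function.support (fun x => (a x : ℂ) * f x) ⊆ tsupport f := fun x hx =>
    subset_tsupport f (right_ne_zero_of_mul hx)
  rw [← integrableOn_iff_integrable_of_support_subset hsub]
  have h1 : MemLp (fun x => (a x : ℂ)) 2 (volume.restrict (tsupport f)) :=
    (ha _ hs.isCompact).ofReal
  exact h1.integrable_mul (hf.restrict (tsupport f))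

/-- Solving g = -i ∂_v f + a f for ∂_v f; compact support of f makes each term integrable against a
test function, so the identity may be split. -/
lemma HasMagneticDeriv.isWeakDeriv {E : Type*} [NormedAddCommGroup E] [NormedSpace ℝ E]
    [MeasureSpace E] [BorelSpace E] [IsFiniteMeasureOnCompacts (volume : Measure E)]
    {v : E} {a : E → ℝ}
    (ha : ∀ K : Set E, IsCompact K → MemLp a 2 (volume.restrict K)) {f g : E → ℂ}
    (hf : MemLp f 2 volume) (hs : HasCompactSupport f) (h : HasMagneticDeriv v a f g) :
    IsWeakDeriv v f (fun x => Complex.I * (g x - a x * f x)) := by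
  intro η hη hsη
  have hη' : ContDiff ℝ ∞ (fun x => (η x : ℂ)) := Complex.ofRealCLM.contDiff.comp hη
  have hs' : HasCompactSupport (fun x => (η x : ℂ)) := hsη.comp_left (g := Complex.ofReal) rfl
  have hd : ∀ x, fderiv ℝ (fun x => (η x : ℂ)) x v = (fderiv ℝ η x v : ℝ) := fun x => by
    have := (Complex.ofRealCLM.hasFDerivAt.comp x
      (hη.differentiable (by simp) x).hasFDerivAt).fderiv
    erw [this]; simp
  have key := h.2 _ hη' hs'
  simp only [hd] at key
  obtain ⟨C, hC⟩ := hη'.continuous.bounded_above_of_compact_support hs'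
  have i1 : Integrable (fun x => η x * g x) volume := by
    simpa [mul_comm] using integrable_mul_test h.1 hη'.continuous hs'
  have i2 : Integrable (fun x => η x * (a x * f x)) volume :=
    (integrable_potential_mul ha hf hs).bdd_mul hη'.continuous.aestronglyMeasurable
      (Eventually.of_forall hC)
  have hdc : Continuous fun x => Complex.I * ((fderiv ℝ η x v : ℝ) : ℂ) :=
    continuous_const.mul (Complex.continuous_ofReal.comp (continuous_fderiv_apply_of_contDiff hη v))
  have i3 : Integrable (fun x => f x * (Complex.I * (fderiv ℝ η x v : ℝ))) volume :=
    integrable_mul_test hf hdc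
      (((hasCompactSupport_fderiv_apply hsη v).comp_left (g := Complex.ofReal) rfl).mul_left)
  have e1 : ∫ x, f x * (Complex.I * (fderiv ℝ η x v : ℝ) + a x * η x)
      = (∫ x, f x * (Complex.I * (fderiv ℝ η x v : ℝ))) + ∫ x, η x * (a x * f x) := by
    rw [← integral_add i3 i2]
    congr 1; ext x; ring
  have e2 : ∫ x, η x • (Complex.I * (g x - a x * f x))
      = Complex.I * ((∫ x, g x * η x) - ∫ x, η x * (a x * f x)) := by
    have : (∫ x, g x * η x) = ∫ x, η x * g x := by congr 1; ext x; ring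
    rw [this, ← integral_sub i1 i2, ← integral_const_mul]
    congr 1; ext x; simp only [Complex.real_smul]; ring
  have e3 : ∫ x, fderiv ℝ η x v • f x
      = -Complex.I * ∫ x, f x * (Complex.I * (fderiv ℝ η x v : ℝ)) := by
    rw [← integral_const_mul]
    congr 1; ext x; simp only [Complex.real_smul]
    linear_combination (((fderiv ℝ η x v : ℝ) : ℂ) * f x) * Complex.I_sq
  rw [e2, e3, key, e1]
  ring

/-- The Gagliardo-Nirenberg-Sobolev constant of `ℝ³`. -/
noncomputable def gnsConst : ℝ≥0 := eLpNormLESNormFDerivOfEqInnerConst (volume : Measure R3) 2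

lemma opNorm_le_sum_basis {F : Type*} [NormedAddCommGroup F] [NormedSpace ℝ F] (L : R3 →L[ℝ] F) :
    ‖L‖ ≤ ∑ j, ‖L (e j)‖ := by
  refine L.opNorm_le_bound (by positivity) fun x => ?_
  have hx : x = ∑ j, x j • e j := by
    ext i
    simp [e, Finset.sum_apply, Pi.single_apply]
  conv_lhs => rw [hx, map_sum]
  rw [Finset.sum_mul]
  refine (norm_sum_le _ _).trans (Finset.sum_le_sum fun j _ => ?_)
  rw [map_smul, norm_smul, mul_comm]
  gcongr
  exact PiLp.norm_apply_le x j

/-- The Sobolev inequality for weakly differentiable functions with compact support. -/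
lemma eLpNorm_six_le_of_isWeakDeriv {u : R3 → ℝ} (hu : Integrable u volume)
    (hs : HasCompactSupport u) {w : Fin 3 → R3 → ℝ} (hw : ∀ j, MemLp (w j) 2 volume)
    (h : ∀ j, IsWeakDeriv (e j) u (w j)) :
    eLpNorm u 6 volume ≤ gnsConst * ∑ j, eLpNorm (w j) 2 volume := by
  have hk := fun k => contDiff_mollify k hu.locallyIntegrable
  have bound : ∀ k, eLpNorm (mollify k u) 6 volume ≤ gnsConst * ∑ j, eLpNorm (w j) 2 volume := by
    intro k
    -- The exponent 6 comes from 1/6 = 1/2 - 1/3. The bound is uniform in k and passes to u by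
    -- Fatou.
    have gns := eLpNorm_le_eLpNorm_fderiv_of_eq_inner (volume : Measure R3) (u := mollify k u)
      ((hk k).of_le (by simp)) (hasCompactSupport_mollify k hs) (p := 2) (p' := 6)
      (by norm_num) (by simp) (by simp; norm_num)
    refine gns.trans ?_
    rw [gnsConst]
    push_cast
    gcongr
    have hc : ∀ j, Continuous (mollify k (w j)) := fun j =>
      (contDiff_mollify k ((hw j).locallyIntegrable (by norm_num))).continuous
    calc eLpNorm (fderiv ℝ (mollify k u)) 2 volume
        ≤ eLpNorm (∑ j, fun x => ‖mollify k (w j) x‖) 2 volume := by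
          refine eLpNorm_mono_real fun x => ?_
          refine (opNorm_le_sum_basis _).trans (le_of_eq ?_)
          simp only [Finset.sum_apply, (h _).fderiv_mollify hu.locallyIntegrable]
      _ ≤ ∑ j, eLpNorm (fun x => ‖mollify k (w j) x‖) 2 volume :=
          eLpNorm_sum_le (fun j _ => (hc j).norm.aestronglyMeasurable) (by norm_num)
      _ ≤ ∑ j, eLpNorm (w j) 2 volume := by
          refine Finset.sum_le_sum fun j _ => ?_
          rw [eLpNorm_norm, eLpNorm_eq_lintegral_rpow_enorm_toReal (by norm_num) (by norm_num),
            eLpNorm_eq_lintegral_rpow_enorm_toReal (by norm_num) (by norm_num)]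
          refine ENNReal.rpow_le_rpow ?_ (by positivity)
          exact lintegral_enorm_mollify_rpow_le k (by norm_num) (hw j).1
  refine (Lp.eLpNorm_lim_le_liminf_eLpNorm
    (fun k => (hk k).continuous.aestronglyMeasurable) u
    (ae_tendsto_mollify hu.locallyIntegrable)).trans ?_
  exact (liminf_le_liminf (Eventually.of_forall bound)).trans (by simp)

/-- The diamagnetic Sobolev inequality for functions with compact support. -/
lemma eLpNorm_six_le_of_hasMagneticDeriv {A : R3 → R3}
    (hA : ∀ j : Fin 3, L2Loc (fun x => A x j)) {f : R3 → ℂ} (hf : MemLp f 2 volume)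
    (hs : HasCompactSupport f) {g : Fin 3 → R3 → ℂ} (hgs : ∀ j, HasCompactSupport (g j))
    (h : ∀ j, HasMagneticDeriv (e j) (fun x => A x j) f (g j)) :
    eLpNorm f 6 volume ≤ gnsConst * ∑ j, eLpNorm (g j) 2 volume := by
  have hfi := integrable_of_memLp_of_hasCompactSupport hf hs
  have hG : ∀ j, Integrable (fun x => Complex.I * (g j x - (A x j : ℝ) * f x)) volume := fun j =>
    ((integrable_of_memLp_of_hasCompactSupport (h j).1 (hgs j)).sub
      (integrable_potential_mul (hA j) hf hs)).const_mul _
  have bound : ∀ κ : ℝ, 0 < κ →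
      eLpNorm (fun x => regNorm κ (f x)) 6 volume ≤ gnsConst * ∑ j, eLpNorm (g j) 2 volume := by
    intro κ hκ
    have hur : Integrable (fun x => regNorm κ (f x)) volume :=
      hfi.mono ((contDiff_regNorm hκ).continuous.comp_aestronglyMeasurable hfi.1)
        (Eventually.of_forall fun x => abs_regNorm_le hκ.le _)
    have hsr : HasCompactSupport (fun x => regNorm κ (f x)) :=
      hs.comp_left (g := regNorm κ) (regNorm_zero hκ.le)
    have hle : ∀ j x, ‖(inner ℝ (regDir κ (f x))
        (Complex.I * (g j x - (A x j : ℝ) * f x)) : ℝ)‖ ≤ ‖g j x‖ := by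
      intro j x
      -- The heart of the diamagnetic inequality: `regDir κ (f x)` is a real multiple of f, and i A
      -- f is orthogonal to f in the real inner product, so the vector potential disappears.
      have e0 : (inner ℝ (regDir κ (f x)) (Complex.I * (g j x - (A x j : ℝ) * f x)) : ℝ)
          = inner ℝ (regDir κ (f x)) (Complex.I * g j x) := by
        rw [mul_sub, inner_sub_right, sub_eq_self, regDir, inner_smul_left, Complex.inner]
        simp
        right; ring
      rw [e0]
      refine (norm_inner_le_norm _ _).trans ?_
      rw [norm_mul, Complex.norm_I, one_mul]
      exact mul_le_of_le_one_left (norm_nonneg _) (norm_regDir_le κ _)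
    have hmw : ∀ j, MemLp (fun x => (inner ℝ (regDir κ (f x))
        (Complex.I * (g j x - (A x j : ℝ) * f x)) : ℝ)) 2 volume := fun j =>
      (h j).1.of_le (((continuous_regDir hκ).comp_aestronglyMeasurable hf.1).inner (hG j).1)
        (Eventually.of_forall (hle j))
    refine (eLpNorm_six_le_of_isWeakDeriv hur hsr hmw fun j =>
      ((h j).isWeakDeriv (hA j) hf hs).regNorm hκ hfi (hG j)).trans ?_
    gcongr with j
    exact eLpNorm_mono (hle j)
  have hlim : ∀ x, Tendsto (fun k : ℕ => regNorm (1 / ((k : ℝ) + 1)) (f x)) atTop (𝓝 ‖f x‖) := by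
    intro x
    have h0 := tendsto_one_div_add_atTop_nhds_zero_nat (𝕜 := ℝ)
    have hc : Continuous fun κ : ℝ => √(‖f x‖ ^ 2 + κ ^ 2) - κ := by fun_prop
    have := (hc.tendsto 0).comp h0
    simpa [regNorm, Function.comp_def] using this
  rw [← eLpNorm_norm f]
  refine (Lp.eLpNorm_lim_le_liminf_eLpNorm (f := fun (k : ℕ) x => regNorm (1 / ((k : ℝ) + 1)) (f x))
    (fun k => (contDiff_regNorm (by positivity)).continuous.comp_aestronglyMeasurable hf.1) _
    (Eventually.of_forall hlim)).trans ?_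
  exact (liminf_le_liminf (Eventually.of_forall fun k => bound _ (by positivity))).trans (by simp)

end Sobolev

/-! ### From local Sobolev bounds to a global form bound. -/

section FormBound

open Filter Topology
open scoped ENNReal

/-- Tonelli and translation invariance. It sums estimates localized at z into a global one by
averaging over all centres. -/
lemma lintegral_lintegral_sub_mul {E : Type*} [NormedAddCommGroup E] [MeasureSpace E]
    [BorelSpace E] [SecondCountableTopology E] [SFinite (volume : Measure E)]
    [(volume : Measure E).IsAddLeftInvariant] [(volume : Measure E).IsNegInvariant]
    {k h : E → ℝ≥0∞} (hk : Measurable k) (hh : AEMeasurable h volume) :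
    ∫⁻ z, ∫⁻ x, k (x - z) * h x = (∫⁻ x, k x) * ∫⁻ x, h x := by
  rw [lintegral_lintegral_swap]
  · rw [← lintegral_const_mul'' _ hh]
    congr 1; ext x
    have hm : Measurable fun z => k (x - z) := hk.comp (measurable_const.sub measurable_id)
    rw [lintegral_mul_const _ hm, lintegral_sub_left_eq_self k x]
  · exact (hk.comp (measurable_snd.sub measurable_fst)).aemeasurable.mul hh.comp_snd

/-- The volume factor in the Hölder inequality on a unit ball of `ℝ³`. -/
noncomputable def ballFactor : ℝ≥0∞ := volume (Metric.ball (0 : R3) 1) ^ (1 / 6 : ℝ)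

lemma ballFactor_ne_top : ballFactor ≠ ⊤ :=
  ENNReal.rpow_ne_top_of_nonneg (by norm_num) measure_ball_lt_top.ne

/-- Cauchy-Schwarz puts W in L² and f in L⁴; on a unit ball L⁴ is controlled by L⁶ at the price of
the volume to the power 1/4 - 1/6 = 1/12, squared in the end. -/
lemma lintegral_mul_sq_le_of_support {W : R3 → ℝ} {z : R3}
    (hW : AEStronglyMeasurable W volume) {f : R3 → ℂ} (hf : AEStronglyMeasurable f volume)
    (hs : ∀ x ∉ Metric.ball z 1, f x = 0) :
    ∫⁻ x, ‖W x‖ₑ * ‖f x‖ₑ ^ 2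
      ≤ eLpNorm W 2 (volume.restrict (Metric.ball z 1)) * (ballFactor * eLpNorm f 6 volume ^ 2) := by
  set μ := (volume : Measure R3).restrict (Metric.ball z 1)
  have hvol : (μ Set.univ) ^ (1 / 6 : ℝ) = ballFactor := by
    rw [Measure.restrict_apply_univ, ballFactor, Measure.addHaar_ball_center]
  have e1 : ∫⁻ x, ‖W x‖ₑ * ‖f x‖ₑ ^ 2 = ∫⁻ x, ‖W x‖ₑ * ‖f x‖ₑ ^ 2 ∂μ := by
    rw [← lintegral_indicator Metric.isOpen_ball.measurableSet]
    congr 1; ext x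
    by_cases hx : x ∈ Metric.ball z 1
    · rw [Set.indicator_of_mem hx]
    · rw [Set.indicator_of_notMem hx, hs x hx]; simp
  have h4 : (∫⁻ x, (‖f x‖ₑ ^ 2) ^ (2 : ℝ) ∂μ) ^ (1 / 2 : ℝ) = eLpNorm f 4 μ ^ 2 := by
    rw [eLpNorm_eq_lintegral_rpow_enorm_toReal (by norm_num) (by norm_num), ← ENNReal.rpow_natCast,
      ← ENNReal.rpow_mul]
    congr 1
    · congr 1; ext x
      rw [← ENNReal.rpow_natCast, ← ENNReal.rpow_mul]
      norm_num
    · norm_num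
  have h46 : eLpNorm f 4 μ ≤ eLpNorm f 6 μ * (μ Set.univ) ^ (1 / 12 : ℝ) := by
    have := eLpNorm_le_eLpNorm_mul_rpow_measure_univ (μ := μ) (p := 4) (q := 6) (by norm_num)
      hf.restrict
    convert this using 3
    norm_num
  have h2 := ENNReal.lintegral_mul_le_Lp_mul_Lq μ (p := 2) (q := 2)
    ⟨by norm_num, by norm_num, by norm_num⟩ (f := fun x => ‖W x‖ₑ) (g := fun x => ‖f x‖ₑ ^ 2)
    hW.restrict.enorm (hf.restrict.enorm.pow_const 2)
  rw [e1]
  refine h2.trans ?_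
  rw [h4]
  gcongr
  · rw [eLpNorm_eq_lintegral_rpow_enorm_toReal (by norm_num) (by norm_num)]
    norm_num
  · calc eLpNorm f 4 μ ^ 2 ≤ (eLpNorm f 6 μ * (μ Set.univ) ^ (1 / 12 : ℝ)) ^ 2 := by gcongr
      _ = (μ Set.univ) ^ (1 / 6 : ℝ) * eLpNorm f 6 μ ^ 2 := by
        rw [mul_pow, mul_comm]
        congr 1
        rw [← ENNReal.rpow_natCast, ← ENNReal.rpow_mul]
        norm_num
      _ ≤ ballFactor * eLpNorm f 6 volume ^ 2 := by
        rw [hvol]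
        gcongr
        exact Measure.restrict_le_self

lemma sum_sq_le_three_mul (x : Fin 3 → ℝ≥0∞) : (∑ j, x j) ^ 2 ≤ 3 * ∑ j, x j ^ 2 := by
  have := ENNReal.rpow_sum_le_const_mul_sum_rpow Finset.univ x (p := 2) (by norm_num)
  norm_num at this
  exact this

lemma add_sq_le_two_mul (x y : ℝ≥0∞) : (x + y) ^ 2 ≤ 2 * (x ^ 2 + y ^ 2) := by
  have := ENNReal.rpow_add_le_mul_rpow_add_rpow x y (p := 2) (by norm_num)
  norm_num at this
  exact this

/-- A smooth cutoff function supported in the unit ball. -/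
noncomputable def cutoff : ContDiffBump (0 : R3) := ⟨1 / 2, 1, by norm_num, by norm_num⟩

lemma aemeasurable_lintegral_sub_mul {k h : R3 → ℝ≥0∞} (hk : Measurable k)
    (hh : AEMeasurable h volume) : AEMeasurable (fun z => ∫⁻ x, k (x - z) * h x) volume := by
  have : AEMeasurable (fun p : R3 × R3 => k (p.2 - p.1) * h p.2) (volume.prod volume) :=
    (hk.comp (measurable_snd.sub measurable_fst)).aemeasurable.mul hh.comp_snd
  exact this.lintegral_prod_right'

lemma eLpNorm_two_sq {α F : Type*} [MeasurableSpace α] [NormedAddCommGroup F] {μ : Measure α}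
    (f : α → F) : eLpNorm f 2 μ ^ 2 = ∫⁻ x, ‖f x‖ₑ ^ 2 ∂μ := by
  rw [eLpNorm_eq_lintegral_rpow_enorm_toReal (by norm_num) (by norm_num), ← ENNReal.rpow_natCast,
    ← ENNReal.rpow_mul]
  norm_num

lemma lintegral_enorm_sq_lt_top {α F : Type*} [MeasurableSpace α] [NormedAddCommGroup F]
    {μ : Measure α} {f : α → F} (hf : MemLp f 2 μ) : ∫⁻ x, ‖f x‖ₑ ^ 2 ∂μ < ⊤ := by
  rw [← eLpNorm_two_sq]
  exact ENNReal.pow_lt_top hf.2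

/-- The local diamagnetic Sobolev inequality on the unit ball around `z`. -/
lemma eLpNorm_six_cutoff_sq_le {A : R3 → R3} (hA : ∀ j : Fin 3, L2Loc (fun x => A x j))
    {φ : R3 → ℂ} (hφ : MemLp φ 2 volume) {g : Fin 3 → R3 → ℂ}
    (h : ∀ j, HasMagneticDeriv (e j) (fun x => A x j) φ (g j)) (z : R3) :
    eLpNorm (fun x => (cutoff (x - z) : ℂ) * φ x) 6 volume ^ 2 ≤ (gnsConst : ℝ≥0∞) ^ 2 * (6 *
      ∑ j, ((∫⁻ x, ‖cutoff (x - z)‖ₑ ^ 2 * ‖g j x‖ₑ ^ 2)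
        + ∫⁻ x, ‖fderiv ℝ cutoff (x - z) (e j)‖ₑ ^ 2 * ‖φ x‖ₑ ^ 2)) := by
  have hc : ContDiff ℝ ∞ (cutoff : R3 → ℝ) := cutoff.contDiff
  have hcs : HasCompactSupport (cutoff : R3 → ℝ) := cutoff.hasCompactSupport
  have hf : ContDiff ℝ ∞ fun x => cutoff (x - z) := hc.comp (contDiff_id.sub contDiff_const)
  have hfs : HasCompactSupport fun x => cutoff (x - z) :=
    hcs.comp_homeomorph (Homeomorph.subRight z)
  have hd : ∀ x, fderiv ℝ (fun x => cutoff (x - z)) x = fderiv ℝ cutoff (x - z) := fun x =>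
    fderiv_comp_sub (f := (cutoff : R3 → ℝ)) z
  obtain ⟨C, hC⟩ := hf.continuous.bounded_above_of_compact_support hfs
  have hder : ∀ j, HasMagneticDeriv (e j) (fun x => A x j) (fun x => (cutoff (x - z) : ℂ) * φ x)
      (fun x => cutoff (x - z) * g j x
        - Complex.I * (fderiv ℝ cutoff (x - z) (e j) : ℝ) * φ x) := by
    intro j
    obtain ⟨C', hC'⟩ := (continuous_fderiv_apply_of_contDiff hf (e j)).bounded_above_of_compact_support
      (hasCompactSupport_fderiv_apply hfs (e j))
    have := (h j).mul_contDiff (hA j) hφ hf hC hC'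
    simpa only [hd] using this
  have hcC : Continuous fun x => (cutoff (x - z) : ℂ) :=
    Complex.continuous_ofReal.comp hf.continuous
  have hcCs : HasCompactSupport fun x => (cutoff (x - z) : ℂ) :=
    hfs.comp_left (g := Complex.ofReal) rfl
  have hms : MemLp (fun x => (cutoff (x - z) : ℂ) * φ x) 2 volume :=
    memLp_bdd_mul hφ hcC.aestronglyMeasurable (C := C) (by simpa using hC)
  have hgs : ∀ j, HasCompactSupport (fun x => cutoff (x - z) * g j x
        - Complex.I * (fderiv ℝ cutoff (x - z) (e j) : ℝ) * φ x) := by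
    intro j
    have h1 := hasCompactSupport_fderiv_apply hfs (e j)
    simp only [hd] at h1
    exact (hcCs.mul_right).sub ((h1.comp_left (g := Complex.ofReal) rfl).mul_left.mul_right)
  have key := eLpNorm_six_le_of_hasMagneticDeriv hA hms hcCs.mul_right hgs hder
  have hdc : ∀ j, Measurable fun x => ‖fderiv ℝ cutoff (x - z) (e j)‖ₑ := fun j => by
    have := continuous_fderiv_apply_of_contDiff hf (e j)
    simp only [hd] at this
    exact this.measurable.enorm
  -- The factor 6 is 3 · 2: squaring the sum over three directions, then squaring the two Leibniz
  -- terms.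
  calc eLpNorm (fun x => (cutoff (x - z) : ℂ) * φ x) 6 volume ^ 2
      ≤ (gnsConst * ∑ j, eLpNorm (fun x => cutoff (x - z) * g j x
        - Complex.I * (fderiv ℝ cutoff (x - z) (e j) : ℝ) * φ x) 2 volume) ^ 2 := by gcongr
    _ ≤ (gnsConst : ℝ≥0∞) ^ 2 * (3 * ∑ j, eLpNorm (fun x => cutoff (x - z) * g j x
        - Complex.I * (fderiv ℝ cutoff (x - z) (e j) : ℝ) * φ x) 2 volume ^ 2) := by
        rw [mul_pow]
        gcongr
        exact sum_sq_le_three_mul _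
    _ ≤ (gnsConst : ℝ≥0∞) ^ 2 * (3 * ∑ j, 2 * ((∫⁻ x, ‖cutoff (x - z)‖ₑ ^ 2 * ‖g j x‖ₑ ^ 2)
        + ∫⁻ x, ‖fderiv ℝ cutoff (x - z) (e j)‖ₑ ^ 2 * ‖φ x‖ₑ ^ 2)) := by
        gcongr with j
        have hm : AEMeasurable (fun x => ‖cutoff (x - z)‖ₑ ^ 2 * ‖g j x‖ₑ ^ 2) volume :=
          (hf.continuous.measurable.enorm.pow_const 2).aemeasurable.mul
            ((h j).1.1.enorm.pow_const 2)
        rw [eLpNorm_two_sq, ← lintegral_add_left' hm,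
          ← lintegral_const_mul' _ _ (by norm_num)]
        refine lintegral_mono fun x => ?_
        calc _ ≤ (‖(cutoff (x - z) : ℂ) * g j x‖ₑ
              + ‖Complex.I * (fderiv ℝ cutoff (x - z) (e j) : ℝ) * φ x‖ₑ) ^ 2 := by
              gcongr; exact enorm_sub_le
          _ ≤ _ := (add_sq_le_two_mul _ _).trans (le_of_eq ?_)
        have n1 : ∀ r : ℝ, ‖(r : ℂ)‖ₑ = ‖r‖ₑ := fun r => by
          rw [← ofReal_norm, ← ofReal_norm, Complex.norm_real]
        have n2 : ‖Complex.I‖ₑ = 1 := by rw [← ofReal_norm]; simp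
        simp only [enorm_mul, mul_pow, n1, n2, one_mul]
    _ = _ := by
        rw [← Finset.mul_sum, ← mul_assoc 3 2]
        norm_num

/-- A potential which is uniformly locally square integrable is form bounded on the magnetic
Sobolev space. -/
lemma exists_lintegral_mul_sq_le {A : R3 → R3} (hA : ∀ j : Fin 3, L2Loc (fun x => A x j))
    {φ : R3 → ℂ} (hφ : φ ∈ H1 A) :
    ∃ B : ℝ≥0∞, B ≠ ⊤ ∧ ∀ (W : R3 → ℝ) (M : ℝ≥0∞), AEStronglyMeasurable W volume → M ≠ ⊤ →
      (∀ z, eLpNorm W 2 (volume.restrict (Metric.ball z 1)) ≤ M) →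
      ∫⁻ x, ‖W x‖ₑ * ‖φ x‖ₑ ^ 2 ≤ M * B := by
  obtain ⟨hφ2, hD⟩ := hφ
  choose g hg using hD
  have hc : ContDiff ℝ ∞ (cutoff : R3 → ℝ) := cutoff.contDiff
  have hcs : HasCompactSupport (cutoff : R3 → ℝ) := cutoff.hasCompactSupport
  set K : ℝ≥0∞ := ∫⁻ x, ‖cutoff x‖ₑ ^ 2
  have mK : Measurable fun x : R3 => ‖cutoff x‖ₑ ^ 2 := hc.continuous.measurable.enorm.pow_const 2
  have hKt : K ≠ ⊤ :=
    (lintegral_enorm_sq_lt_top (hc.continuous.memLp_of_hasCompactSupport hcs)).ne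
  have hK0 : K ≠ 0 := by
    intro h0
    rw [lintegral_eq_zero_iff mK] at h0
    have hcont : Continuous fun x : R3 => ‖cutoff x‖ₑ ^ 2 := by
      have := hc.continuous.enorm
      fun_prop
    have := (Continuous.ae_eq_iff_eq volume hcont continuous_const).1 h0
    have h1 := congrFun this 0
    have : cutoff (0 : R3) = 1 := cutoff.one_of_mem_closedBall
      (Metric.mem_closedBall_self cutoff.rIn_pos.le)
    simp [this] at h1
  set K' : Fin 3 → ℝ≥0∞ := fun j => ∫⁻ x, ‖fderiv ℝ cutoff x (e j)‖ₑ ^ 2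
  have hdc : ∀ j, Continuous fun x => fderiv ℝ cutoff x (e j) := fun j =>
    continuous_fderiv_apply_of_contDiff hc (e j)
  have mK' : ∀ j, Measurable fun x => ‖fderiv ℝ cutoff x (e j)‖ₑ ^ 2 := fun j =>
    (hdc j).measurable.enorm.pow_const 2
  have hK't : ∀ j, K' j ≠ ⊤ := fun j =>
    (lintegral_enorm_sq_lt_top ((hdc j).memLp_of_hasCompactSupport
      (hasCompactSupport_fderiv_apply hcs (e j)))).ne
  set S : ℝ≥0∞ := ∑ j, (K * (∫⁻ x, ‖g j x‖ₑ ^ 2) + K' j * ∫⁻ x, ‖φ x‖ₑ ^ 2)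
  have hSt : S ≠ ⊤ := by
    refine ENNReal.sum_ne_top.2 fun j _ => ENNReal.add_ne_top.2 ⟨?_, ?_⟩
    · exact ENNReal.mul_ne_top hKt (lintegral_enorm_sq_lt_top (hg j).1).ne
    · exact ENNReal.mul_ne_top (hK't j) (lintegral_enorm_sq_lt_top hφ2).ne
  set c : ℝ≥0∞ := ballFactor * ((gnsConst : ℝ≥0∞) ^ 2 * 6)
  have hct : c ≠ ⊤ := ENNReal.mul_ne_top ballFactor_ne_top
    (ENNReal.mul_ne_top (by simp) (by norm_num))
  -- This constant does not involve W, which later allows the weights 1/|x - y| for all y at once.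
  -- The factor K⁻¹ undoes the average of the squared cutoff over its centres.
  refine ⟨K⁻¹ * (c * S), ENNReal.mul_ne_top (ENNReal.inv_ne_top.2 hK0)
    (ENNReal.mul_ne_top hct hSt), fun W M hW hM hWM => ?_⟩
  have main : K * ∫⁻ x, ‖W x‖ₑ * ‖φ x‖ₑ ^ 2 ≤ M * (c * S) := by
    have mφ : AEMeasurable (fun x => ‖φ x‖ₑ ^ 2) volume := hφ2.1.enorm.pow_const 2
    have mW : AEMeasurable (fun x => ‖W x‖ₑ * ‖φ x‖ₑ ^ 2) volume := hW.enorm.mul mφ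
    rw [← lintegral_lintegral_sub_mul mK mW]
    calc ∫⁻ z, ∫⁻ x, ‖cutoff (x - z)‖ₑ ^ 2 * (‖W x‖ₑ * ‖φ x‖ₑ ^ 2)
        ≤ ∫⁻ z, M * (c * ∑ j, ((∫⁻ x, ‖cutoff (x - z)‖ₑ ^ 2 * ‖g j x‖ₑ ^ 2)
          + ∫⁻ x, ‖fderiv ℝ cutoff (x - z) (e j)‖ₑ ^ 2 * ‖φ x‖ₑ ^ 2)) := by
          refine lintegral_mono fun z => ?_
          have hcz : AEStronglyMeasurable (fun x => (cutoff (x - z) : ℂ) * φ x) volume :=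
            (Complex.continuous_ofReal.comp (hc.continuous.comp
              (continuous_id.sub continuous_const))).aestronglyMeasurable.mul hφ2.1
          have h1 := lintegral_mul_sq_le_of_support hW (z := z) hcz (fun x hx => by
            have : x - z ∉ Function.support (cutoff : R3 → ℝ) := by
              rw [cutoff.support_eq]
              simpa [cutoff, dist_eq_norm] using hx
            simp [Function.notMem_support.1 this])
          have n1 : ∀ r : ℝ, ‖(r : ℂ)‖ₑ = ‖r‖ₑ := fun r => by
            rw [← ofReal_norm, ← ofReal_norm, Complex.norm_real]
          calc ∫⁻ x, ‖cutoff (x - z)‖ₑ ^ 2 * (‖W x‖ₑ * ‖φ x‖ₑ ^ 2)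
              = ∫⁻ x, ‖W x‖ₑ * ‖(cutoff (x - z) : ℂ) * φ x‖ₑ ^ 2 := by
                congr 1; ext x
                rw [enorm_mul, mul_pow, n1]; ring
            _ ≤ _ := h1
            _ ≤ M * (ballFactor * ((gnsConst : ℝ≥0∞) ^ 2 * (6 * _))) := by
                gcongr
                · exact hWM z
                · exact eLpNorm_six_cutoff_sq_le hA hφ2 hg z
            _ = _ := by simp only [c]; ring
      _ = M * (c * S) := by
          rw [lintegral_const_mul' _ _ hM, lintegral_const_mul' _ _ hct]
          congr 2
          have m1 : ∀ j, AEMeasurable (fun z =>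
              ∫⁻ x, ‖cutoff (x - z)‖ₑ ^ 2 * ‖g j x‖ₑ ^ 2) volume := fun j =>
            aemeasurable_lintegral_sub_mul mK ((hg j).1.1.enorm.pow_const 2)
          have m2 : ∀ j, AEMeasurable (fun z =>
              ∫⁻ x, ‖fderiv ℝ cutoff (x - z) (e j)‖ₑ ^ 2 * ‖φ x‖ₑ ^ 2) volume := fun j =>
            aemeasurable_lintegral_sub_mul (mK' j) mφ
          have m12 : ∀ j, AEMeasurable (fun z =>
              (∫⁻ x, ‖cutoff (x - z)‖ₑ ^ 2 * ‖g j x‖ₑ ^ 2)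
              + ∫⁻ x, ‖fderiv ℝ cutoff (x - z) (e j)‖ₑ ^ 2 * ‖φ x‖ₑ ^ 2) volume := fun j =>
            (m1 j).add (m2 j)
          rw [lintegral_finsetSum' _ fun j _ => m12 j]
          refine Finset.sum_congr rfl fun j _ => ?_
          rw [lintegral_add_left' (m1 j),
            lintegral_lintegral_sub_mul mK ((hg j).1.1.enorm.pow_const 2),
            lintegral_lintegral_sub_mul (mK' j) mφ]
  calc ∫⁻ x, ‖W x‖ₑ * ‖φ x‖ₑ ^ 2 = K⁻¹ * (K * ∫⁻ x, ‖W x‖ₑ * ‖φ x‖ₑ ^ 2) := by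
        rw [← mul_assoc, ENNReal.inv_mul_cancel hK0 hKt, one_mul]
    _ ≤ K⁻¹ * (M * (c * S)) := by gcongr
    _ = M * (K⁻¹ * (c * S)) := by ring

end FormBound

/-! ### Application to V and to the Coulomb kernel. -/

section Potentials

open Filter Topology
open scoped ENNReal

lemma laplacian_comp_sub (f : R3 → ℂ) (z x : R3) :
    (Δ fun y => f (y - z)) x = (Δ f) (x - z) := by
  simp only [InnerProductSpace.laplacian_eq_iteratedFDeriv_stdOrthonormalBasis]
  simp [iteratedFDeriv_comp_sub]

lemma L2Loc.aestronglyMeasurable {V : R3 → ℝ} (hV : L2Loc V) :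
    AEStronglyMeasurable V volume := by
  have h : ∀ n : ℕ, AEStronglyMeasurable V (volume.restrict (Metric.closedBall (0 : R3) n)) :=
    fun n => (hV _ (isCompact_closedBall 0 n)).1
  have := aestronglyMeasurable_iUnion_iff.2 h
  rwa [Metric.iUnion_closedBall_nat, Measure.restrict_univ] at this

lemma continuous_laplacian {η : R3 → ℂ} (hη : ContDiff ℝ ∞ η) : Continuous (Δ η) := by
  have hi : Continuous (iteratedFDeriv ℝ 2 η) :=
    hη.continuous_iteratedFDeriv (m := 2)
      (WithTop.coe_le_coe.2 (le_top : (2 : ℕ∞) ≤ ⊤))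
  rw [InnerProductSpace.laplacian_eq_iteratedFDeriv_stdOrthonormalBasis]
  refine continuous_finsetSum _ fun i _ => ?_
  exact (ContinuousMultilinearMap.apply ℝ (fun _ : Fin 2 => R3) ℂ _).continuous.comp hi

lemma hasCompactSupport_laplacian {η : R3 → ℂ} (hs : HasCompactSupport η) :
    HasCompactSupport (Δ η) := by
  refine (hs.iteratedFDeriv (𝕜 := ℝ) 2).mono fun x hx => ?_
  rw [Function.mem_support] at hx ⊢
  contrapose! hx
  simp [InnerProductSpace.laplacian_eq_iteratedFDeriv_stdOrthonormalBasis, hx]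

/-- An infinitesimally small potential is uniformly locally square integrable. -/
lemma InfinitesimallySmall.exists_eLpNorm_ball_le {V : R3 → ℝ} (hV : InfinitesimallySmall V) :
    ∃ M : ℝ≥0∞, M ≠ ⊤ ∧ ∀ z, eLpNorm V 2 (volume.restrict (Metric.ball z 1)) ≤ M := by
  -- The bound with ε = 1 is tested on translates of a bump equal to 1 on the unit ball; its
  -- right-hand side is translation invariant.
  obtain ⟨C, hC⟩ := hV 1 one_pos
  obtain ⟨b, hb⟩ : ∃ b : ContDiffBump (0 : R3), b.rIn = 1 :=
    ⟨⟨1, 2, by norm_num, by norm_num⟩, rfl⟩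
  obtain ⟨η, hηb⟩ : ∃ η : R3 → ℂ, η = fun x => (b x : ℂ) := ⟨_, rfl⟩
  have hη : ContDiff ℝ ∞ η := hηb ▸ Complex.ofRealCLM.contDiff.comp b.contDiff
  have hs : HasCompactSupport η := hηb ▸ b.hasCompactSupport.comp_left (g := Complex.ofReal) rfl
  have hΔ : Continuous (Δ η) := continuous_laplacian hη
  have hΔs : HasCompactSupport (Δ η) := hasCompactSupport_laplacian hs
  refine ⟨eLpNorm (Δ η) 2 volume + C * eLpNorm η 2 volume, ?_, fun z => ?_⟩
  · exact ENNReal.add_ne_top.2 ⟨(hΔ.memLp_of_hasCompactSupport hΔs).2.ne,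
      ENNReal.mul_ne_top (by simp) (hη.continuous.memLp_of_hasCompactSupport hs).2.ne⟩
  have mp : MeasurePreserving (fun x : R3 => x - z) volume volume :=
    measurePreserving_sub_right volume z
  have key := hC (fun x => η (x - z)) (hη.comp (contDiff_id.sub contDiff_const))
    (hs.comp_homeomorph (Homeomorph.subRight z))
  have e1 : eLpNorm (Δ fun x => η (x - z)) 2 volume = eLpNorm (Δ η) 2 volume := by
    rw [← eLpNorm_comp_measurePreserving hΔ.aestronglyMeasurable mp]
    congr 1; ext x; exact laplacian_comp_sub η z x
  have e2 : eLpNorm (fun x => η (x - z)) 2 volume = eLpNorm η 2 volume :=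
    eLpNorm_comp_measurePreserving hη.continuous.aestronglyMeasurable mp
  rw [e1, e2, ENNReal.coe_one, one_mul] at key
  refine le_trans ?_ key
  refine le_trans ?_ (eLpNorm_mono_measure _
    (Measure.restrict_le_self (s := Metric.ball z 1)))
  refine eLpNorm_mono_ae ((ae_restrict_iff' Metric.isOpen_ball.measurableSet).2
    (Eventually.of_forall fun x hx => ?_))
  have h1 : b (x - z) = 1 := b.one_of_mem_closedBall (by
    simpa [hb, dist_eq_norm] using (Metric.mem_ball.1 hx).le)
  simp [hηb, h1]

/-- In polar coordinates the Jacobian r² cancels the singularity r⁻². -/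
lemma lintegral_ball_inv_norm_sq_lt_top :
    ∫⁻ x in Metric.ball (0 : R3) 1, ‖(1 / ‖x‖ : ℝ)‖ₑ ^ 2 < ⊤ := by
  have h1 : Integrable (fun x : R3 => (Set.Ioo (-1 : ℝ) 1).indicator (fun r => (1 / r) ^ 2) ‖x‖)
      volume := by
    rw [integrable_fun_norm_addHaar]
    have e : Set.EqOn (fun y : ℝ => y ^ (Module.finrank ℝ R3 - 1) •
        (Set.Ioo (-1 : ℝ) 1).indicator (fun r => (1 / r) ^ 2) y)
        ((Set.Ioo (-1 : ℝ) 1).indicator 1) (Set.Ioi 0) := by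
      intro y hy
      have hy0 : y ≠ 0 := ne_of_gt hy
      by_cases hm : y ∈ Set.Ioo (-1 : ℝ) 1
      · simp [Set.indicator_of_mem hm, hy0]
      · simp [Set.indicator_of_notMem hm]
    refine IntegrableOn.congr_fun ?_ e.symm measurableSet_Ioi
    exact (((integrable_indicator_iff measurableSet_Ioo).2
      (integrableOn_const (by simp))).integrableOn)
  have h2 := h1.2
  rw [hasFiniteIntegral_iff_enorm] at h2
  refine lt_of_le_of_lt ?_ h2
  rw [← lintegral_indicator Metric.isOpen_ball.measurableSet]
  refine lintegral_mono fun x => ?_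
  by_cases hx : x ∈ Metric.ball (0 : R3) 1
  · have hm : ‖x‖ ∈ Set.Ioo (-1 : ℝ) 1 := ⟨by linarith [norm_nonneg x], by simpa using hx⟩
    rw [Set.indicator_of_mem hx, Set.indicator_of_mem hm, enorm_pow]
  · rw [Set.indicator_of_notMem hx]; exact zero_le

/-- The Coulomb potential is uniformly locally square integrable. -/
lemma exists_eLpNorm_inv_norm_sub_ball_le :
    ∃ M : ℝ≥0∞, M ≠ ⊤ ∧ ∀ y z : R3,
      eLpNorm (fun x => 1 / ‖x - y‖) 2 (volume.restrict (Metric.ball z 1)) ≤ M := by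
  set I := ∫⁻ x in Metric.ball (0 : R3) 1, ‖(1 / ‖x‖ : ℝ)‖ₑ ^ 2
  have hvol : volume (Metric.ball (0 : R3) 1) ≠ ⊤ := measure_ball_lt_top.ne
  refine ⟨(I + volume (Metric.ball (0 : R3) 1)) ^ (1 / 2 : ℝ), ?_, fun y z => ?_⟩
  · exact ENNReal.rpow_ne_top_of_nonneg (by norm_num)
      (ENNReal.add_ne_top.2 ⟨lintegral_ball_inv_norm_sq_lt_top.ne, hvol⟩)
  rw [eLpNorm_eq_lintegral_rpow_enorm_toReal (by norm_num) (by norm_num)]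
  refine ENNReal.rpow_le_rpow ?_ (by norm_num)
  have hm : Measurable fun x : R3 => (Metric.ball (0 : R3) 1).indicator
      (fun x => ‖(1 / ‖x‖ : ℝ)‖ₑ ^ 2) x := by
    refine Measurable.indicator ?_ Metric.isOpen_ball.measurableSet
    exact ((measurable_norm.const_div 1).enorm).pow_const 2
  -- Split at distance 1 from y: the singular part is at most its integral over the full unit ball
  -- about y, and elsewhere the kernel is at most 1. Neither bound sees y or z.
  calc ∫⁻ x in Metric.ball z 1, ‖1 / ‖x - y‖‖ₑ ^ (2 : ℝ≥0∞).toReal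
      ≤ ∫⁻ x in Metric.ball z 1, ((Metric.ball (0 : R3) 1).indicator
          (fun x => ‖(1 / ‖x‖ : ℝ)‖ₑ ^ 2) (x - y) + 1) := by
        refine lintegral_mono fun x => ?_
        by_cases hx : x - y ∈ Metric.ball (0 : R3) 1
        · rw [Set.indicator_of_mem hx]
          simp
        · rw [Set.indicator_of_notMem hx, zero_add]
          have h1 : (1 : ℝ) ≤ ‖x - y‖ := by simpa using hx
          have h2 : ‖1 / ‖x - y‖‖ₑ ≤ 1 := by
            rw [← enorm_one (G := ℝ), enorm_le_iff_norm_le, norm_one,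
              Real.norm_of_nonneg (by positivity)]
            exact (div_le_one (by linarith)).2 h1
          exact ENNReal.rpow_le_one h2 (by norm_num)
    _ = (∫⁻ x in Metric.ball z 1, (Metric.ball (0 : R3) 1).indicator
          (fun x => ‖(1 / ‖x‖ : ℝ)‖ₑ ^ 2) (x - y)) + volume (Metric.ball (0 : R3) 1) := by
        rw [lintegral_add_right _ measurable_const]
        simp [Measure.addHaar_ball_center]
    _ ≤ I + volume (Metric.ball (0 : R3) 1) := by
        gcongr
        refine (lintegral_mono' Measure.restrict_le_self le_rfl).trans ?_
        rw [lintegral_sub_right_eq_self (fun x => (Metric.ball (0 : R3) 1).indicator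
          (fun x => ‖(1 / ‖x‖ : ℝ)‖ₑ ^ 2) x) y,
          lintegral_indicator Metric.isOpen_ball.measurableSet]

variable {A : R3 → R3} {V : R3 → ℝ} {φ : R3 → ℂ}

lemma enorm_mul_norm_sq (r : ℝ) (z : ℂ) : ‖r * ‖z‖ ^ 2‖ₑ = ‖r‖ₑ * ‖z‖ₑ ^ 2 := by
  rw [enorm_mul, enorm_pow, enorm_norm]

/-- Infinitesimal smallness enters only through the uniform local L² bound on V, to which the form
bound applies. -/
lemma integrable_potential_mul_norm_sq (hA : ∀ j : Fin 3, L2Loc (fun x => A x j)) (hV : L2Loc V)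
    (hVs : InfinitesimallySmall V) (hφ : φ ∈ H1 A) :
    Integrable (fun x => V x * ‖φ x‖ ^ 2) volume := by
  obtain ⟨B, hB, h⟩ := exists_lintegral_mul_sq_le hA hφ
  obtain ⟨M, hM, hVM⟩ := hVs.exists_eLpNorm_ball_le
  refine ⟨hV.aestronglyMeasurable.mul (hφ.1.1.norm.pow 2), ?_⟩
  rw [hasFiniteIntegral_iff_enorm]
  simp only [enorm_mul_norm_sq]
  exact (h V M hV.aestronglyMeasurable hM hVM).trans_lt (ENNReal.mul_lt_top hM.lt_top hB.lt_top)

/-- The Coulomb potential of a density in the magnetic Sobolev space is bounded. -/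
lemma exists_integral_coulomb_le (hA : ∀ j : Fin 3, L2Loc (fun x => A x j)) (hφ : φ ∈ H1 A) :
    ∃ C : ℝ, 0 ≤ C ∧ ∀ y, Integrable (fun x => ‖φ x‖ ^ 2 / ‖x - y‖) volume ∧
      ∫ x, ‖φ x‖ ^ 2 / ‖x - y‖ ≤ C := by
  obtain ⟨B, hB, h⟩ := exists_lintegral_mul_sq_le hA hφ
  obtain ⟨M, hM, hc⟩ := exists_eLpNorm_inv_norm_sub_ball_le
  have hMB : M * B ≠ ⊤ := ENNReal.mul_ne_top hM hB
  have hmw : ∀ y : R3, AEStronglyMeasurable (fun x : R3 => 1 / ‖x - y‖) volume := fun y =>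
    (((measurable_id.sub measurable_const).norm).const_div 1).aestronglyMeasurable
  have key : ∀ y, ∫⁻ x, ‖‖φ x‖ ^ 2 / ‖x - y‖‖ₑ ≤ M * B := by
    intro y
    refine le_trans (le_of_eq ?_) (h _ M (hmw y) hM (hc y))
    congr 1; ext x
    rw [← enorm_mul_norm_sq]
    congr 1; ring
  have hmeas : ∀ y, AEStronglyMeasurable (fun x => ‖φ x‖ ^ 2 / ‖x - y‖) volume := fun y => by
    have := (hφ.1.1.norm.pow 2).mul (hmw y)
    refine this.congr (Eventually.of_forall fun x => ?_)
    simp [div_eq_mul_inv]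
  refine ⟨(M * B).toReal, ENNReal.toReal_nonneg, fun y => ⟨⟨hmeas y, ?_⟩, ?_⟩⟩
  · rw [hasFiniteIntegral_iff_enorm]
    exact (key y).trans_lt hMB.lt_top
  · rw [integral_eq_lintegral_of_nonneg_ae (Eventually.of_forall fun x => by positivity) (hmeas y)]
    refine ENNReal.toReal_mono hMB (le_trans (le_of_eq ?_) (key y))
    congr 1; ext x
    rw [Real.enorm_of_nonneg (by positivity)]

/-- The Coulomb energy density of a function in the magnetic Sobolev space is integrable. -/
lemma integrable_coulomb (hA : ∀ j : Fin 3, L2Loc (fun x => A x j)) (hφ : φ ∈ H1 A) :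
    Integrable (fun p : R3 × R3 => ‖φ p.1‖ ^ 2 * ‖φ p.2‖ ^ 2 / ‖p.1 - p.2‖) volume := by
  obtain ⟨C, hC0, hC⟩ := exists_integral_coulomb_le hA hφ
  have hn : Integrable (fun x => ‖φ x‖ ^ 2) volume :=
    (memLp_two_iff_integrable_sq_norm hφ.1.1).1 hφ.1
  have hm : AEStronglyMeasurable (fun p : R3 × R3 => ‖φ p.1‖ ^ 2 * ‖φ p.2‖ ^ 2 / ‖p.1 - p.2‖)
      (volume.prod volume) := by
    have h1 : AEStronglyMeasurable (fun p : R3 × R3 => ‖φ p.1‖ ^ 2 * ‖φ p.2‖ ^ 2)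
      (volume.prod volume) := hn.1.comp_fst.mul hn.1.comp_snd
    have h2 : Measurable fun p : R3 × R3 => ‖p.1 - p.2‖⁻¹ :=
      (measurable_fst.sub measurable_snd).norm.inv
    exact h1.mul h2.aestronglyMeasurable
  rw [Measure.volume_eq_prod, integrable_prod_iff' hm]
  have e : ∀ x y : R3, ‖φ x‖ ^ 2 * ‖φ y‖ ^ 2 / ‖x - y‖ = ‖φ y‖ ^ 2 * (‖φ x‖ ^ 2 / ‖x - y‖) :=
    fun x y => by ring
  refine ⟨Eventually.of_forall fun y => ?_, ?_⟩
  · simp only [e]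
    exact (hC y).1.const_mul _
  · refine (hn.const_mul C).mono ?_ (Eventually.of_forall fun y => ?_)
    · have := hm.norm.prod_swap.integral_prod_right'
      exact this
    · dsimp only
      have : ∀ x, ‖‖φ x‖ ^ 2 * ‖φ y‖ ^ 2 / ‖x - y‖‖ = ‖φ y‖ ^ 2 * (‖φ x‖ ^ 2 / ‖x - y‖) :=
        fun x => by rw [Real.norm_of_nonneg (by positivity), e]
      simp only [this, integral_const_mul]
      have h0 : 0 ≤ ∫ x, ‖φ x‖ ^ 2 / ‖x - y‖ := integral_nonneg fun x => by positivity
      rw [Real.norm_of_nonneg (by positivity), Real.norm_of_nonneg (by positivity), mul_comm]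
      gcongr
      exact (hC y).2

end Potentials

/-! ### First variation along normalized multiplicative perturbations. -/

section Variation

open Filter Topology

/-- The first order condition at a minimum of a quotient of polynomials. -/
lemma first_variation_eq {K₀ K₁ K₂ N₁ N₂ C₀ C₁ C₂ C₃ C₄ : ℝ}
    (h : ∀ t : ℝ, 0 < 1 + t * N₁ + t ^ 2 * N₂ → K₀ - C₀ ≤
      (K₀ + t * K₁ + t ^ 2 * K₂) / (1 + t * N₁ + t ^ 2 * N₂)
        - (C₀ + t * C₁ + t ^ 2 * C₂ + t ^ 3 * C₃ + t ^ 4 * C₄)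
          / (1 + t * N₁ + t ^ 2 * N₂) ^ 2) :
    K₁ = (K₀ - 2 * C₀) * N₁ + C₁ := by
  -- The assumed inequality multiplied by the squared mass. This polynomial vanishes at 0 and is
  -- nonnegative nearby on both sides, so its derivative at 0 is zero.
  set P : ℝ → ℝ := fun t => (K₀ + t * K₁ + t ^ 2 * K₂) * (1 + t * N₁ + t ^ 2 * N₂)
    - (C₀ + t * C₁ + t ^ 2 * C₂ + t ^ 3 * C₃ + t ^ 4 * C₄)
    - (K₀ - C₀) * (1 + t * N₁ + t ^ 2 * N₂) ^ 2 with hP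
  have hpos : ∀ᶠ t in 𝓝 (0 : ℝ), 0 < 1 + t * N₁ + t ^ 2 * N₂ := by
    have hc : Continuous fun t : ℝ => 1 + t * N₁ + t ^ 2 * N₂ := by fun_prop
    exact (hc.tendsto 0).eventually (lt_mem_nhds (by norm_num))
  have hmin : IsLocalMin P 0 := by
    filter_upwards [hpos] with t ht
    have h0 : P 0 = 0 := by simp [hP]
    rw [h0]
    have := h t ht
    set N := 1 + t * N₁ + t ^ 2 * N₂
    have e : P t = ((K₀ + t * K₁ + t ^ 2 * K₂) / N
        - (C₀ + t * C₁ + t ^ 2 * C₂ + t ^ 3 * C₃ + t ^ 4 * C₄) / N ^ 2 - (K₀ - C₀)) * N ^ 2 := by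
      have hN : 1 + t * N₁ + t ^ 2 * N₂ = N := rfl
      simp only [hP, hN]
      field_simp
    rw [e]
    exact mul_nonneg (by linarith) (by positivity)
  have hd : HasDerivAt P (K₁ + K₀ * N₁ - C₁ - 2 * (K₀ - C₀) * N₁) 0 := by
    have quad : ∀ a b c : ℝ, HasDerivAt (fun t : ℝ => a + t * b + t ^ 2 * c) b 0 := fun a b c => by
      have := ((hasDerivAt_id (0 : ℝ)).mul_const b).const_add a |>.add
        (((hasDerivAt_id (0 : ℝ)).pow 2).mul_const c)
      exact this.congr_deriv (by simp)
    have cub : HasDerivAt (fun t : ℝ => t ^ 3 * C₃ + t ^ 4 * C₄) 0 0 := by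
      have := (((hasDerivAt_id (0 : ℝ)).pow 3).mul_const C₃).add
        (((hasDerivAt_id (0 : ℝ)).pow 4).mul_const C₄)
      exact this.congr_deriv (by simp)
    have := (((quad K₀ K₁ K₂).mul (quad 1 N₁ N₂)).sub ((quad C₀ C₁ C₂).add cub)).sub
      (((quad 1 N₁ N₂).pow 2).const_mul (K₀ - C₀))
    refine (this.congr_deriv (by norm_num; ring)).congr_of_eventuallyEq
      (Eventually.of_forall fun t => ?_)
    simp only [hP, Pi.sub_apply, Pi.mul_apply, Pi.add_apply, Pi.pow_apply]
    ring
  have := hmin.hasDerivAt_eq_zero hd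
  linarith

variable {α : Type*} [MeasurableSpace α] {μ : Measure α}

/-- The normalized perturbation `c (1 + t f) ψ`. -/
noncomputable def perturb (c t : ℝ) (f : α → ℝ) (ψ : α → ℂ) : α → ℂ :=
  fun x => c * (ψ x + t * (f x * ψ x))

/-- The derivative of `perturb c t f ψ` in terms of derivatives `f'` of `f` and `g` of `ψ`. -/
noncomputable def perturbDeriv (c t : ℝ) (f f' : α → ℝ) (ψ g : α → ℂ) : α → ℂ :=
  fun x => c * (g x + t * (f x * g x - Complex.I * f' x * ψ x))

lemma norm_sq_perturb (c t : ℝ) (f : α → ℝ) (ψ : α → ℂ) (x : α) :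
    ‖perturb c t f ψ x‖ ^ 2 = c ^ 2 * ((1 + t * f x) ^ 2 * ‖ψ x‖ ^ 2) := by
  have : perturb c t f ψ x = ((c * (1 + t * f x) : ℝ) : ℂ) * ψ x := by
    simp [perturb]; ring
  rw [this, norm_mul, Complex.norm_real, mul_pow, Real.norm_eq_abs, sq_abs]
  ring

/-- A bounded measurable real multiplier preserves integrability. -/
lemma integrable_bdd_mul {f h : α → ℝ} (hh : Integrable h μ) (hf : AEStronglyMeasurable f μ)
    {C : ℝ} (hC : ∀ x, |f x| ≤ C) : Integrable (fun x => f x * h x) μ :=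
  hh.bdd_mul hf (Eventually.of_forall hC)

lemma integral_quadratic {a₀ a₁ a₂ : α → ℝ} (h₀ : Integrable a₀ μ) (h₁ : Integrable a₁ μ)
    (h₂ : Integrable a₂ μ) (t : ℝ) :
    ∫ x, (a₀ x + t * a₁ x + t ^ 2 * a₂ x) ∂μ
      = ∫ x, a₀ x ∂μ + t * ∫ x, a₁ x ∂μ + t ^ 2 * ∫ x, a₂ x ∂μ := by
  have h₁' := h₁.const_mul t
  have h₂' := h₂.const_mul (t ^ 2)
  have h₀₁ : Integrable (fun x => a₀ x + t * a₁ x) μ := h₀.add h₁'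
  rw [integral_add h₀₁ h₂', integral_add h₀ h₁', integral_const_mul, integral_const_mul]

/-- Expansion of the perturbed mass with respect to a weight. -/
lemma integral_one_add_sq_mul {f w : α → ℝ} (hw : Integrable w μ) (hf : AEStronglyMeasurable f μ)
    {C : ℝ} (hC : ∀ x, |f x| ≤ C) (t : ℝ) :
    ∫ x, (1 + t * f x) ^ 2 * w x ∂μ
      = ∫ x, w x ∂μ + t * (2 * ∫ x, f x * w x ∂μ) + t ^ 2 * ∫ x, f x ^ 2 * w x ∂μ := by
  have i1 := integrable_bdd_mul hw hf hC
  have i2 : Integrable (fun x => f x ^ 2 * w x) μ := by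
    have := integrable_bdd_mul i1 hf hC
    exact this.congr (Eventually.of_forall fun x => by ring)
  have := integral_quadratic hw (i1.const_mul 2) i2 t
  rw [integral_const_mul] at this
  rw [← this]
  congr 1; ext x; ring

lemma integrable_inner_of_memLp_two {f g : α → ℂ} (hf : MemLp f 2 μ) (hg : MemLp g 2 μ) :
    Integrable (fun x => (inner ℝ (f x) (g x) : ℝ)) μ := by
  have h := hf.norm.integrable_mul hg.norm
  refine h.mono (hf.1.inner hg.1) (Eventually.of_forall fun x => ?_)
  simpa using norm_inner_le_norm (𝕜 := ℝ) (f x) (g x)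

lemma integrable_norm_sq_of_memLp_two {f : α → ℂ} (hf : MemLp f 2 μ) :
    Integrable (fun x => ‖f x‖ ^ 2) μ :=
  (memLp_two_iff_integrable_sq_norm hf.1).1 hf

lemma memLp_perturbation {f f' : α → ℝ} {ψ g : α → ℂ} (hψ : MemLp ψ 2 μ) (hg : MemLp g 2 μ)
    (hf : AEStronglyMeasurable f μ) {C : ℝ} (hC : ∀ x, |f x| ≤ C)
    (hf' : AEStronglyMeasurable f' μ) {C' : ℝ} (hC' : ∀ x, |f' x| ≤ C') :
    MemLp (fun x => f x * g x - Complex.I * f' x * ψ x) 2 μ := by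
  have h1 : MemLp (fun x => f x * g x) 2 μ :=
    memLp_bdd_mul hg (Complex.continuous_ofReal.comp_aestronglyMeasurable hf) (C := C)
      (by simpa using hC)
  have h2 : MemLp (fun x => Complex.I * f' x * ψ x) 2 μ :=
    memLp_bdd_mul hψ ((Complex.continuous_ofReal.comp_aestronglyMeasurable hf').const_mul _)
      (C := C') (by simpa using hC')
  exact h1.sub h2

/-- The first variation of the one-body energy density in the direction `f ψ`. -/
noncomputable def energyVariation (f : α → ℝ) (f' : Fin 3 → α → ℝ) (V : α → ℝ) (ψ : α → ℂ)
    (g : Fin 3 → α → ℂ) (x : α) : ℝ :=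
  (∑ j, 2 * inner ℝ (g j x) (f x * g j x - Complex.I * f' j x * ψ x))
    + 2 * (f x * (V x * ‖ψ x‖ ^ 2))

lemma integrable_energyVariation {f : α → ℝ} {f' : Fin 3 → α → ℝ} {V : α → ℝ} {ψ : α → ℂ}
    {g : Fin 3 → α → ℂ} (hψ : MemLp ψ 2 μ) (hg : ∀ j, MemLp (g j) 2 μ)
    (hV : Integrable (fun x => V x * ‖ψ x‖ ^ 2) μ)
    (hf : AEStronglyMeasurable f μ) {C : ℝ} (hC : ∀ x, |f x| ≤ C)
    (hf' : ∀ j, AEStronglyMeasurable (f' j) μ) {C' : Fin 3 → ℝ} (hC' : ∀ j x, |f' j x| ≤ C' j) :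
    Integrable (energyVariation f f' V ψ g) μ :=
  (integrable_finsetSum _ fun j _ => (integrable_inner_of_memLp_two (hg j)
    (memLp_perturbation hψ (hg j) hf hC (hf' j) (hC' j))).const_mul 2).add
    ((integrable_bdd_mul hV hf hC).const_mul 2)

lemma integrable_energyDensity {V : α → ℝ} {ψ : α → ℂ}
    {g : Fin 3 → α → ℂ} (hg : ∀ j, MemLp (g j) 2 μ)
    (hV : Integrable (fun x => V x * ‖ψ x‖ ^ 2) μ) :
    Integrable (fun x => (∑ j, ‖g j x‖ ^ 2) + V x * ‖ψ x‖ ^ 2) μ :=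
  (integrable_finsetSum _ fun j _ => integrable_norm_sq_of_memLp_two (hg j)).add hV

/-- Expansion of the one-body energy of a perturbed state. -/
lemma exists_integral_perturb_energy_eq {f : α → ℝ} {f' : Fin 3 → α → ℝ} {V : α → ℝ} {ψ : α → ℂ}
    {g : Fin 3 → α → ℂ} (hψ : MemLp ψ 2 μ) (hg : ∀ j, MemLp (g j) 2 μ)
    (hV : Integrable (fun x => V x * ‖ψ x‖ ^ 2) μ)
    (hf : AEStronglyMeasurable f μ) {C : ℝ} (hC : ∀ x, |f x| ≤ C)
    (hf' : ∀ j, AEStronglyMeasurable (f' j) μ) {C' : Fin 3 → ℝ} (hC' : ∀ j x, |f' j x| ≤ C' j) :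
    ∃ K₂ : ℝ, ∀ c t : ℝ,
      ∫ x, ((∑ j, ‖perturbDeriv c t f (f' j) ψ (g j) x‖ ^ 2) + V x * ‖perturb c t f ψ x‖ ^ 2) ∂μ
      = c ^ 2 * ((∫ x, ((∑ j, ‖g j x‖ ^ 2) + V x * ‖ψ x‖ ^ 2) ∂μ)
        + t * ∫ x, energyVariation f f' V ψ g x ∂μ + t ^ 2 * K₂) := by
  have hb := fun j => memLp_perturbation hψ (hg j) hf hC (hf' j) (hC' j)
  have i2 : Integrable (fun x => (∑ j, ‖f x * g j x - Complex.I * f' j x * ψ x‖ ^ 2)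
      + f x * (f x * (V x * ‖ψ x‖ ^ 2))) μ :=
    (integrable_finsetSum _ fun j _ => integrable_norm_sq_of_memLp_two (hb j)).add
      (integrable_bdd_mul (integrable_bdd_mul hV hf hC) hf hC)
  refine ⟨∫ x, ((∑ j, ‖f x * g j x - Complex.I * f' j x * ψ x‖ ^ 2)
      + f x * (f x * (V x * ‖ψ x‖ ^ 2))) ∂μ, fun c t => ?_⟩
  rw [← integral_quadratic (integrable_energyDensity hg hV)
    (integrable_energyVariation hψ hg hV hf hC hf' hC') i2 t, ← integral_const_mul]
  congr 1; ext x
  have hn : ∀ j, ‖perturbDeriv c t f (f' j) ψ (g j) x‖ ^ 2 = c ^ 2 * (‖g j x‖ ^ 2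
      + t * (2 * inner ℝ (g j x) (f x * g j x - Complex.I * f' j x * ψ x))
      + t ^ 2 * ‖f x * g j x - Complex.I * f' j x * ψ x‖ ^ 2) := fun j => by
    rw [perturbDeriv, norm_mul, mul_pow, Complex.norm_real, Real.norm_eq_abs, sq_abs,
      ← Complex.real_smul (x := t), norm_add_sq_real, inner_smul_right, norm_smul, mul_pow,
      Real.norm_eq_abs, sq_abs]
    ring
  simp only [hn, norm_sq_perturb, energyVariation, ← Finset.mul_sum, Finset.sum_add_distrib]
  ring

/-- Expansion of a quadratic form with kernel `k` evaluated at `1 + t a + t² b`. -/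
lemma exists_integral_kernel_eq {β : Type*} [MeasureSpace β] [SFinite (volume : Measure β)]
    {k : β × β → ℝ} (hk : Integrable k volume) (hsymm : ∀ p, k p.swap = k p)
    {a b : β → ℝ} (ha : AEStronglyMeasurable a volume) {C : ℝ} (hC : ∀ x, |a x| ≤ C)
    (hb : AEStronglyMeasurable b volume) {C' : ℝ} (hC' : ∀ x, |b x| ≤ C') :
    ∃ C₂ C₃ C₄ : ℝ, ∀ t : ℝ,
      ∫ p : β × β, (1 + t * a p.1 + t ^ 2 * b p.1) * (1 + t * a p.2 + t ^ 2 * b p.2) * k p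
      = (∫ p, k p) + t * (2 * ∫ p : β × β, a p.1 * k p) + t ^ 2 * C₂ + t ^ 3 * C₃ + t ^ 4 * C₄ := by
  have swap_int : ∫ p : β × β, a p.2 * k p = ∫ p : β × β, a p.1 * k p := by
    rw [Measure.volume_eq_prod, ← integral_prod_swap]
    simp [hsymm]
  have a1 : ∀ {h : β × β → ℝ}, Integrable h volume →
      Integrable (fun p => a p.1 * h p) volume := fun hh =>
    integrable_bdd_mul hh ha.comp_fst (fun p => hC p.1)
  have a2 : ∀ {h : β × β → ℝ}, Integrable h volume →
      Integrable (fun p => a p.2 * h p) volume := fun hh =>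
    integrable_bdd_mul hh ha.comp_snd (fun p => hC p.2)
  have b1 : ∀ {h : β × β → ℝ}, Integrable h volume →
      Integrable (fun p => b p.1 * h p) volume := fun hh =>
    integrable_bdd_mul hh hb.comp_fst (fun p => hC' p.1)
  have b2 : ∀ {h : β × β → ℝ}, Integrable h volume →
      Integrable (fun p => b p.2 * h p) volume := fun hh =>
    integrable_bdd_mul hh hb.comp_snd (fun p => hC' p.2)
  have q1 : Integrable (fun p => a p.1 * k p + a p.2 * k p) volume := (a1 hk).add (a2 hk)
  have q2 : Integrable (fun p => b p.1 * k p + b p.2 * k p + a p.1 * (a p.2 * k p)) volume :=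
    ((b1 hk).add (b2 hk)).add (a1 (a2 hk))
  have q3 : Integrable (fun p => a p.1 * (b p.2 * k p) + b p.1 * (a p.2 * k p)) volume :=
    (a1 (b2 hk)).add (b1 (a2 hk))
  have q4 : Integrable (fun p => b p.1 * (b p.2 * k p)) volume := b1 (b2 hk)
  refine ⟨∫ p, (b p.1 * k p + b p.2 * k p + a p.1 * (a p.2 * k p)),
    ∫ p, (a p.1 * (b p.2 * k p) + b p.1 * (a p.2 * k p)), ∫ p, b p.1 * (b p.2 * k p), fun t => ?_⟩
  have e1 : 2 * ∫ p : β × β, a p.1 * k p = ∫ p, (a p.1 * k p + a p.2 * k p) := by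
    rw [integral_add (a1 hk) (a2 hk), swap_int]; ring
  have s2 : Integrable (fun p => k p + t * (a p.1 * k p + a p.2 * k p)
      + t ^ 2 * (b p.1 * k p + b p.2 * k p + a p.1 * (a p.2 * k p))) volume :=
    (hk.add (q1.const_mul t)).add (q2.const_mul (t ^ 2))
  have s3 : Integrable (fun p => k p + t * (a p.1 * k p + a p.2 * k p)
      + t ^ 2 * (b p.1 * k p + b p.2 * k p + a p.1 * (a p.2 * k p))
      + t ^ 3 * (a p.1 * (b p.2 * k p) + b p.1 * (a p.2 * k p))) volume :=
    s2.add (q3.const_mul (t ^ 3))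
  rw [e1, ← integral_quadratic hk q1 q2, ← integral_const_mul (t ^ 3),
    ← integral_add s2 (q3.const_mul (t ^ 3)), ← integral_const_mul (t ^ 4),
    ← integral_add s3 (q4.const_mul (t ^ 4))]
  congr 1; ext p; ring

end Variation

/-! ### Perturbed states stay in the magnetic Sobolev space. -/

lemma HasMagneticDeriv.perturb {E : Type*} [NormedAddCommGroup E] [NormedSpace ℝ E]
    [MeasureSpace E] [BorelSpace E] [IsFiniteMeasureOnCompacts (volume : Measure E)]
    {v : E} {a : E → ℝ}
    (ha : ∀ K : Set E, IsCompact K → MemLp a 2 (volume.restrict K)) {ψ g : E → ℂ}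
    (hψ : MemLp ψ 2 volume) (h : HasMagneticDeriv v a ψ g) {f : E → ℝ} (hf : ContDiff ℝ ∞ f)
    {C : ℝ} (hC : ∀ x, |f x| ≤ C) {C' : ℝ} (hC' : ∀ x, |fderiv ℝ f x v| ≤ C') (c t : ℝ) :
    HasMagneticDeriv v a (perturb c t f ψ)
      (perturbDeriv c t f (fun x => fderiv ℝ f x v) ψ g) := by
  have hm : MemLp (fun x => (f x : ℂ) * ψ x) 2 volume :=
    memLp_bdd_mul hψ (Complex.continuous_ofReal.comp hf.continuous).aestronglyMeasurable (C := C)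
      (by simpa using hC)
  exact (h.add ha hψ (hm.const_mul t) ((h.mul_contDiff ha hψ hf hC hC').const_mul t)).const_mul c

lemma memLp_perturb {α : Type*} [MeasurableSpace α] {μ : Measure α} {f : α → ℝ} {ψ : α → ℂ}
    (hψ : MemLp ψ 2 μ) (hf : AEStronglyMeasurable f μ) {C : ℝ} (hC : ∀ x, |f x| ≤ C) (c t : ℝ) :
    MemLp (perturb c t f ψ) 2 μ :=
  (hψ.add ((memLp_bdd_mul hψ (Complex.continuous_ofReal.comp_aestronglyMeasurable hf) (C := C)
    (by simpa using hC)).const_mul (t : ℂ))).const_mul (c : ℂ)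

/-! ### Euler-Lagrange equation of the Pekar minimizer. -/

section EulerLagrange

open Filter Topology

variable {A : R3 → R3} {V : R3 → ℝ}

/-- The Coulomb energy density `|φ(x)|² |φ(y)|² / |x - y|`. -/
noncomputable def coulombDensity (φ : R3 → ℂ) (p : R3 × R3) : ℝ :=
  ‖φ p.1‖ ^ 2 * ‖φ p.2‖ ^ 2 / ‖p.1 - p.2‖

lemma coulombDensity_swap (φ : R3 → ℂ) (p : R3 × R3) :
    coulombDensity φ p.swap = coulombDensity φ p := by
  simp only [coulombDensity, Prod.fst_swap, Prod.snd_swap, norm_sub_rev p.2 p.1]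
  ring

/-- The one-body energy in terms of arbitrary representatives of the magnetic derivatives. -/
noncomputable def oneBodyEnergy (V : R3 → ℝ) (φ : R3 → ℂ) (g : Fin 3 → R3 → ℂ) : ℝ :=
  ∫ x, ((∑ j, ‖g j x‖ ^ 2) + V x * ‖φ x‖ ^ 2)

/-- `magneticDeriv` is chosen abstractly, but representatives agree almost everywhere, so explicit
ones may be used. -/
lemma pekar_eq {ψ : R3 → ℂ} {g : Fin 3 → R3 → ℂ}
    (h : ∀ j, HasMagneticDeriv (e j) (fun x => A x j) ψ (g j)) :
    pekar A V ψ = oneBodyEnergy V ψ g - coulomb (fun x => ‖ψ x‖ ^ 2) := by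
  rw [pekar, oneBodyEnergy]
  congr 1
  refine integral_congr_ae ?_
  have hall : ∀ᵐ x, ∀ j, D A j ψ x = g j x :=
    ae_all_iff.2 fun j => (h j).magneticDeriv_ae_eq
  filter_upwards [hall] with x hx
  simp only [hx]

lemma coulomb_norm_sq (φ : R3 → ℂ) :
    coulomb (fun x => ‖φ x‖ ^ 2) = ∫ p, coulombDensity φ p := rfl

/-- The Euler-Lagrange equation of a Pekar minimizer, tested against `f φ` with real `f`. -/
lemma IsPekarMinimizer.integral_energyVariation_eq (hA : ∀ j : Fin 3, L2Loc (fun x => A x j))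
    (hV : L2Loc V) (hVs : InfinitesimallySmall V) {φ : R3 → ℂ} (hφ : IsPekarMinimizer A V φ)
    {g : Fin 3 → R3 → ℂ} (hg : ∀ j, HasMagneticDeriv (e j) (fun x => A x j) φ (g j))
    {f : R3 → ℝ} (hf : ContDiff ℝ ∞ f) {C : ℝ} (hC : ∀ x, |f x| ≤ C) {C' : Fin 3 → ℝ}
    (hC' : ∀ j x, |fderiv ℝ f x (e j)| ≤ C' j) :
    ∫ x, energyVariation f (fun j x => fderiv ℝ f x (e j)) V φ g x
      = (oneBodyEnergy V φ g - 2 * ∫ p, coulombDensity φ p) * (2 * ∫ x, f x * ‖φ x‖ ^ 2)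
        + 4 * ∫ p : R3 × R3, f p.1 * coulombDensity φ p := by
  obtain ⟨⟨hH, hnorm⟩, hmin⟩ := hφ
  have hn := integrable_norm_sq_of_memLp_two hH.1
  have hVn := integrable_potential_mul_norm_sq hA hV hVs hH
  have hk : Integrable (coulombDensity φ) volume := integrable_coulomb hA hH
  have hfm : AEStronglyMeasurable f volume := hf.continuous.aestronglyMeasurable
  obtain ⟨K₂, hK⟩ := exists_integral_perturb_energy_eq hH.1 (fun j => (hg j).1) hVn hfm hC
    (fun j => (continuous_fderiv_apply_of_contDiff hf (e j)).aestronglyMeasurable) hC'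
  have hC2 : ∀ x, |f x ^ 2| ≤ C ^ 2 := fun x => by
    rw [abs_pow]; exact pow_le_pow_left₀ (abs_nonneg _) (hC x) 2
  have hC1 : ∀ x, |2 * f x| ≤ 2 * C := fun x => by
    rw [abs_mul, abs_two]; gcongr; exact hC x
  -- The density is multiplied by (1 + t f)² = 1 + t (2f) + t² f², whence these two coefficients.
  obtain ⟨C₂, C₃, C₄, hc⟩ := exists_integral_kernel_eq hk (coulombDensity_swap φ)
    (a := fun x => 2 * f x) (b := fun x => f x ^ 2) (hfm.const_mul 2) hC1 (hfm.pow 2) hC2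
  have hN := integral_one_add_sq_mul hn hfm hC
  have hcoul : ∀ c t : ℝ, coulomb (fun x => ‖perturb c t f φ x‖ ^ 2)
      = c ^ 4 * ∫ p : R3 × R3, (1 + t * (2 * f p.1) + t ^ 2 * f p.1 ^ 2)
          * (1 + t * (2 * f p.2) + t ^ 2 * f p.2 ^ 2) * coulombDensity φ p := by
    intro c t
    rw [coulomb, ← integral_const_mul]
    congr 1; ext p
    simp only [norm_sq_perturb, coulombDensity]
    ring
  have hfirst := first_variation_eq (K₀ := oneBodyEnergy V φ g)
    (K₁ := ∫ x, energyVariation f (fun j x => fderiv ℝ f x (e j)) V φ g x) (K₂ := K₂)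
    (N₁ := 2 * ∫ x, f x * ‖φ x‖ ^ 2) (N₂ := ∫ x, f x ^ 2 * ‖φ x‖ ^ 2)
    (C₀ := ∫ p, coulombDensity φ p)
    (C₁ := 2 * ∫ p : R3 × R3, 2 * f p.1 * coulombDensity φ p) (C₂ := C₂) (C₃ := C₃) (C₄ := C₄) ?_
  · rw [hfirst]
    simp only [mul_assoc, integral_const_mul]
    ring
  intro t ht
  rw [hnorm] at hN
  set N := 1 + t * (2 * ∫ x, f x * ‖φ x‖ ^ 2) + t ^ 2 * ∫ x, f x ^ 2 * ‖φ x‖ ^ 2 with hNdef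
  -- Normalization of the perturbed state: the one-body energy scales with c² = 1/N, the quartic
  -- Coulomb term with c⁴ = 1/N².
  set c := (√N)⁻¹
  have hc2 : c ^ 2 = N⁻¹ := by rw [inv_pow, Real.sq_sqrt ht.le]
  have hc4 : c ^ 4 = (N ^ 2)⁻¹ := by
    rw [show c ^ 4 = (c ^ 2) ^ 2 by ring, hc2, inv_pow]
  have hder := fun j => (hg j).perturb (hA j) hH.1 hf hC (hC' j) c t
  have hmem : perturb c t f φ ∈ pekarDomain A 1 := by
    refine ⟨⟨memLp_perturb hH.1 hfm hC c t, fun j => ⟨_, hder j⟩⟩, ?_⟩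
    simp only [norm_sq_perturb]
    rw [integral_const_mul, hN t, ← hNdef, hc2, inv_mul_cancel₀ ht.ne']
  have hle := isMinOn_iff.1 hmin _ hmem
  have hK' : oneBodyEnergy V (perturb c t f φ)
      (fun j => perturbDeriv c t f (fun x => fderiv ℝ f x (e j)) φ (g j))
      = c ^ 2 * (oneBodyEnergy V φ g
        + t * (∫ x, energyVariation f (fun j x => fderiv ℝ f x (e j)) V φ g x) + t ^ 2 * K₂) :=
    hK c t
  rw [pekar_eq hg, pekar_eq hder, coulomb_norm_sq, hcoul c t, hc t, hK', hc2, hc4] at hle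
  rw [div_eq_inv_mul, div_eq_inv_mul]
  exact hle

end EulerLagrange

/-! ### Energy and first variation for correlated product states. -/

section PairEnergy

open Filter Topology

variable {A : R3 → R3} {V : R3 → ℝ} {φ : R3 → ℂ} {h : R3 → ℝ}

/-- The product state `φ ⊗ φ`. -/
def productState (φ : R3 → ℂ) (p : R3 × R3) : ℂ := φ p.1 * φ p.2

/-- The function `h(x₁ - x₂)`. -/
def relFun (h : R3 → ℝ) (p : R3 × R3) : ℝ := h (p.1 - p.2)

/-- The convolution `h * |φ|²`. -/
noncomputable def smear (h : R3 → ℝ) (φ : R3 → ℂ) (x : R3) : ℝ := ∫ y, h (x - y) * ‖φ y‖ ^ 2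

lemma norm_sq_productState (φ : R3 → ℂ) (p : R3 × R3) :
    ‖productState φ p‖ ^ 2 = ‖φ p.1‖ ^ 2 * ‖φ p.2‖ ^ 2 := by
  rw [productState, norm_mul, mul_pow]

lemma memLp_productState (hφ : MemLp φ 2 volume) : MemLp (productState φ) 2 volume :=
  memLp_two_tensor hφ hφ

lemma contDiff_relFun (hh : ContDiff ℝ ∞ h) : ContDiff ℝ ∞ (relFun h) :=
  hh.comp (contDiff_fst.sub contDiff_snd)

lemma fderiv_relFun (hh : ContDiff ℝ ∞ h) (p : R3 × R3) (v : R3) :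
    fderiv ℝ (relFun h) p (v, 0) = fderiv ℝ h (p.1 - p.2) v := by
  have : HasFDerivAt (relFun h) ((fderiv ℝ h (p.1 - p.2)).comp
      (ContinuousLinearMap.fst ℝ R3 R3 - ContinuousLinearMap.snd ℝ R3 R3)) p :=
    HasFDerivAt.comp (f := fun p : R3 × R3 => p.1 - p.2) p
      (hh.differentiable (by simp) (p.1 - p.2)).hasFDerivAt (hasFDerivAt_fst.sub hasFDerivAt_snd)
  simp [this.fderiv]

/-- The Pekar-Tomasevich energy of a symmetric state. -/
lemma pekarTomasevich_eq_of_symm {U : ℝ} {ψ : R3 × R3 → ℂ} (hsymm : ∀ p, ψ p.swap = ψ p)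
    {g : Fin 3 → R3 × R3 → ℂ}
    (hg : ∀ j, HasMagneticDeriv (e j, (0 : R3)) (fun x : R3 × R3 => A x.1 j) ψ (g j)) :
    pekarTomasevich A V U ψ = 2 * (∫ x : R3 × R3, ((∑ j, ‖g j x‖ ^ 2) + V x.1 * ‖ψ x‖ ^ 2))
      + U * (∫ x : R3 × R3, ‖ψ x‖ ^ 2 / ‖x.1 - x.2‖) - coulomb (pairDensity ψ) := by
  have hg2 : ∀ j, HasMagneticDeriv ((0 : R3), e j) (fun x : R3 × R3 => A x.2 j) ψ
      (fun p => g j p.swap) := fun j => by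
    have := HasMagneticDeriv.swap (a := fun x => A x j) (hg j)
    simpa only [hsymm] using this
  have h1 : ∫ x : R3 × R3, ((∑ j, ‖D₁ A j ψ x‖ ^ 2) + V x.1 * ‖ψ x‖ ^ 2)
      = ∫ x : R3 × R3, ((∑ j, ‖g j x‖ ^ 2) + V x.1 * ‖ψ x‖ ^ 2) := by
    refine integral_congr_ae ?_
    have hall : ∀ᵐ x, ∀ j, D₁ A j ψ x = g j x :=
      ae_all_iff.2 fun j => (hg j).magneticDeriv_ae_eq
    filter_upwards [hall] with x hx
    simp only [hx]
  have h2 : ∫ x : R3 × R3, ((∑ j, ‖D₂ A j ψ x‖ ^ 2) + V x.2 * ‖ψ x‖ ^ 2)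
      = ∫ x : R3 × R3, ((∑ j, ‖g j x‖ ^ 2) + V x.1 * ‖ψ x‖ ^ 2) := by
    have e1 : ∫ x : R3 × R3, ((∑ j, ‖D₂ A j ψ x‖ ^ 2) + V x.2 * ‖ψ x‖ ^ 2)
        = ∫ x : R3 × R3, ((∑ j, ‖g j x.swap‖ ^ 2) + V x.swap.1 * ‖ψ x.swap‖ ^ 2) := by
      refine integral_congr_ae ?_
      have hall : ∀ᵐ x, ∀ j, D₂ A j ψ x = g j x.swap :=
        ae_all_iff.2 fun j => (hg2 j).magneticDeriv_ae_eq
      filter_upwards [hall] with x hx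
      simp only [hx, hsymm, Prod.fst_swap]
    rw [e1, Measure.volume_eq_prod]
    exact integral_prod_swap (fun x : R3 × R3 => (∑ j, ‖g j x‖ ^ 2) + V x.1 * ‖ψ x‖ ^ 2)
  rw [pekarTomasevich, h1, h2]
  ring

lemma integral_norm_sq_productState (hφ : ∫ x, ‖φ x‖ ^ 2 = 1) :
    ∫ p, ‖productState φ p‖ ^ 2 = 1 := by
  simp only [norm_sq_productState]
  rw [Measure.volume_eq_prod, integral_prod_mul (fun x => ‖φ x‖ ^ 2) (fun x => ‖φ x‖ ^ 2), hφ,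
    one_mul]

/-- Evenness of h keeps the trial state symmetric, so both particles contribute equally and only the
first variable needs treatment. -/
lemma perturb_productState_swap (heven : ∀ x, h (-x) = h x) (c t : ℝ) (p : R3 × R3) :
    perturb c t (relFun h) (productState φ) p.swap
      = perturb c t (relFun h) (productState φ) p := by
  have h1 : relFun h p.swap = relFun h p := by
    rw [relFun, relFun, ← heven (p.1 - p.2), neg_sub]; rfl
  have h2 : productState φ p.swap = productState φ p := mul_comm _ _
  simp only [perturb, h1, h2]

lemma aestronglyMeasurable_smear (hh : Continuous h) (hφ : MemLp φ 2 volume) :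
    AEStronglyMeasurable (smear h φ) volume := by
  have hm : AEStronglyMeasurable (fun p : R3 × R3 => h (p.1 - p.2) * ‖φ p.2‖ ^ 2)
      (volume.prod volume) :=
    (hh.comp (continuous_fst.sub continuous_snd)).aestronglyMeasurable.mul
      ((hφ.1.comp_snd).norm.pow 2)
  exact hm.integral_prod_right'

lemma abs_smear_le {C : ℝ} (hC : ∀ x, |h x| ≤ C) (hφ : MemLp φ 2 volume)
    (hφ1 : ∫ x, ‖φ x‖ ^ 2 = 1) (x : R3) : |smear h φ x| ≤ C := by
  have hn := integrable_norm_sq_of_memLp_two hφ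
  have : ‖smear h φ x‖ ≤ ∫ y, C * ‖φ y‖ ^ 2 := by
    refine norm_integral_le_of_norm_le (hn.const_mul C) (Eventually.of_forall fun y => ?_)
    rw [norm_mul, Real.norm_of_nonneg (by positivity : 0 ≤ ‖φ y‖ ^ 2)]
    gcongr
    exact hC _
  rwa [integral_const_mul, hφ1, mul_one] at this

/-- The density of the perturbed product state. -/
lemma pairDensity_perturb (hh : Continuous h) {C : ℝ} (hC : ∀ x, |h x| ≤ C)
    (heven : ∀ x, h (-x) = h x) (hφ : MemLp φ 2 volume) (hφ1 : ∫ x, ‖φ x‖ ^ 2 = 1)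
    (c t : ℝ) (x : R3) :
    pairDensity (perturb c t (relFun h) (productState φ)) x
      = 2 * c ^ 2 * (‖φ x‖ ^ 2 * (1 + t * (2 * smear h φ x)
        + t ^ 2 * smear (fun z => h z ^ 2) φ x)) := by
  have hn := integrable_norm_sq_of_memLp_two hφ
  have e1 : ∀ y, ‖perturb c t (relFun h) (productState φ) (x, y)‖ ^ 2
      + ‖perturb c t (relFun h) (productState φ) (y, x)‖ ^ 2
      = 2 * c ^ 2 * ‖φ x‖ ^ 2 * ((1 + t * h (x - y)) ^ 2 * ‖φ y‖ ^ 2) := fun y => by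
    rw [← perturb_productState_swap heven c t (y, x), Prod.swap_prod_mk, norm_sq_perturb,
      norm_sq_productState, relFun]
    ring
  rw [pairDensity]
  simp only [e1]
  rw [integral_const_mul, integral_one_add_sq_mul hn
    (f := fun y => h (x - y)) (hh.comp (continuous_const.sub continuous_id)).aestronglyMeasurable
    (fun _ => hC _), hφ1]
  simp only [smear]
  ring

lemma inner_mul_right_right (a b c : ℂ) :
    (inner ℝ (a * c) (b * c) : ℝ) = ‖c‖ ^ 2 * inner ℝ a b := by
  simp only [Complex.inner, map_mul, Complex.sq_norm, Complex.normSq_apply, Complex.mul_re,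
    Complex.mul_im, Complex.conj_re, Complex.conj_im]
  ring

/-- The first variation of the kinetic and potential energy of one particle in the product state
of a Pekar minimizer. -/
lemma IsPekarMinimizer.integral_energyVariation_relFun
    (hA : ∀ j : Fin 3, L2Loc (fun x => A x j))
    (hV : L2Loc V) (hVs : InfinitesimallySmall V) (hφ : IsPekarMinimizer A V φ)
    {g : Fin 3 → R3 → ℂ} (hg : ∀ j, HasMagneticDeriv (e j) (fun x => A x j) φ (g j))
    (hh : ContDiff ℝ ∞ h) {C : ℝ} (hC : ∀ x, |h x| ≤ C) {C' : Fin 3 → ℝ}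
    (hC' : ∀ j x, |fderiv ℝ h x (e j)| ≤ C' j) :
    ∫ p, energyVariation (relFun h) (fun j p => fderiv ℝ (relFun h) p (e j, 0))
        (fun p : R3 × R3 => V p.1) (productState φ) (fun j p => g j p.1 * φ p.2) p
      = (oneBodyEnergy V φ g - 2 * ∫ p, coulombDensity φ p)
          * (2 * ∫ p : R3 × R3, relFun h p * ‖productState φ p‖ ^ 2)
        + 4 * ∫ p : R3 × R3, smear h φ p.1 * coulombDensity φ p := by
  have hH := hφ.1.1
  have hn := integrable_norm_sq_of_memLp_two hH.1
  have hVn := integrable_potential_mul_norm_sq hA hV hVs hH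
  have hk : Integrable (coulombDensity φ) volume := integrable_coulomb hA hH
  have hrel := contDiff_relFun hh
  have hVp : Integrable (fun p : R3 × R3 => V p.1 * ‖productState φ p‖ ^ 2) volume := by
    have := hVn.mul_prod hn
    refine this.congr (Eventually.of_forall fun p => ?_)
    simp only [norm_sq_productState]
    ring
  have hint := integrable_energyVariation (f := relFun h)
    (f' := fun j p => fderiv ℝ (relFun h) p (e j, 0)) (memLp_productState hH.1)
    (fun j => memLp_two_tensor (hg j).1 hH.1) hVp hrel.continuous.aestronglyMeasurable
    (fun p => hC (p.1 - p.2))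
    (fun j => (continuous_fderiv_apply_of_contDiff hrel _).aestronglyMeasurable)
    (C' := C') (fun j p => by rw [fderiv_relFun hh]; exact hC' j _)
  have hshift : ∀ y : R3, ContDiff ℝ ∞ fun x => h (x - y) := fun y =>
    hh.comp (contDiff_id.sub contDiff_const)
  -- For frozen y, the pair variation is |φ(y)|² times the one-particle variation in the direction
  -- h(· - y) φ. The Euler-Lagrange equation thus applies for each y and is then integrated against
  -- |φ(y)|².
  have hslice : ∀ x y : R3, energyVariation (relFun h) (fun j p => fderiv ℝ (relFun h) p (e j, 0))
      (fun p : R3 × R3 => V p.1) (productState φ) (fun j p => g j p.1 * φ p.2) (x, y)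
      = ‖φ y‖ ^ 2 * energyVariation (fun x => h (x - y))
        (fun j x => fderiv ℝ (fun x => h (x - y)) x (e j)) V φ g x := by
    intro x y
    have hin : ∀ j, (inner ℝ (g j x * φ y) (h (x - y) * (g j x * φ y)
        - Complex.I * (fderiv ℝ h (x - y) (e j) : ℝ) * (φ x * φ y)) : ℝ)
        = ‖φ y‖ ^ 2 * inner ℝ (g j x) (h (x - y) * g j x
          - Complex.I * (fderiv ℝ h (x - y) (e j) : ℝ) * φ x) := fun j => by
      rw [← inner_mul_right_right]
      congr 1
      ring
    simp only [energyVariation, fderiv_relFun hh, norm_sq_productState,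
      fderiv_comp_sub (f := h)]
    simp only [relFun, productState, hin, mul_add, Finset.mul_sum]
    congr 1
    · refine Finset.sum_congr rfl fun j _ => ?_
      ring
    · ring
  have hEL := fun y : R3 => hφ.integral_energyVariation_eq hA hV hVs hg (hshift y)
    (fun x => hC (x - y)) (C' := C') (fun j x => by
      rw [fderiv_comp_sub (f := h)]; exact hC' j _)
  rw [Measure.volume_eq_prod] at hint ⊢
  rw [integral_prod_symm _ hint]
  simp only [hslice, integral_const_mul, hEL]
  have iG : Integrable (fun p : R3 × R3 => relFun h p * ‖productState φ p‖ ^ 2)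
      (volume.prod volume) :=
    integrable_bdd_mul (integrable_norm_sq_of_memLp_two (memLp_productState hH.1))
      hrel.continuous.aestronglyMeasurable (fun p => hC (p.1 - p.2))
  have iP : Integrable (fun z : R3 × (R3 × R3) =>
      h (z.2.1 - z.1) * (‖φ z.1‖ ^ 2 * coulombDensity φ z.2)) (volume.prod volume) :=
    integrable_bdd_mul (hn.mul_prod hk)
      (hh.continuous.comp (by fun_prop)).aestronglyMeasurable (fun z => hC _)
  have eG : ∀ y, ∫ x, relFun h (x, y) * ‖productState φ (x, y)‖ ^ 2
      = ‖φ y‖ ^ 2 * ∫ x, h (x - y) * ‖φ x‖ ^ 2 := fun y => by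
    rw [← integral_const_mul]
    congr 1; ext x
    rw [norm_sq_productState, relFun]; ring
  have eP : ∀ y, ∫ p : R3 × R3, h (p.1 - y) * (‖φ y‖ ^ 2 * coulombDensity φ p)
      = ‖φ y‖ ^ 2 * ∫ p : R3 × R3, h (p.1 - y) * coulombDensity φ p := fun y => by
    rw [← integral_const_mul]
    congr 1; ext p; ring
  have jG : Integrable (fun y => ‖φ y‖ ^ 2 * ∫ x, h (x - y) * ‖φ x‖ ^ 2) volume := by
    have := iG.integral_prod_right
    simpa only [eG] using this
  have jP : Integrable (fun y => ‖φ y‖ ^ 2 * ∫ p : R3 × R3, h (p.1 - y) * coulombDensity φ p)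
      volume := by
    have := iP.integral_prod_left
    simpa only [eP] using this
  have hG : ∫ p : R3 × R3, relFun h p * ‖productState φ p‖ ^ 2 ∂(volume.prod volume)
      = ∫ y, ‖φ y‖ ^ 2 * ∫ x, h (x - y) * ‖φ x‖ ^ 2 := by
    rw [integral_prod_symm _ iG]
    simp only [eG]
  -- Exchanging the order of integration, the average over y of h(x - y) becomes the convolution h *
  -- |φ|².
  have hP : ∫ p : R3 × R3, smear h φ p.1 * coulombDensity φ p ∂(volume.prod volume)
      = ∫ y, ‖φ y‖ ^ 2 * ∫ p : R3 × R3, h (p.1 - y) * coulombDensity φ p := by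
    simp only [← eP]
    rw [integral_integral_swap iP]
    congr 1; ext p
    rw [smear, ← integral_mul_const]
    congr 1; ext y
    rw [mul_assoc]
  rw [Measure.volume_eq_prod] at jP
  rw [hG, hP, Measure.volume_eq_prod]
  set κ := oneBodyEnergy V φ g - 2 * ∫ p, coulombDensity φ p ∂(volume.prod volume)
  have split : ∀ y, ‖φ y‖ ^ 2 * (κ * (2 * ∫ x, h (x - y) * ‖φ x‖ ^ 2)
      + 4 * ∫ p : R3 × R3, h (p.1 - y) * coulombDensity φ p ∂(volume.prod volume))
      = κ * 2 * (‖φ y‖ ^ 2 * ∫ x, h (x - y) * ‖φ x‖ ^ 2)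
        + 4 * (‖φ y‖ ^ 2 * ∫ p : R3 × R3, h (p.1 - y) * coulombDensity φ p
          ∂(volume.prod volume)) := fun y => by ring
  rw [integral_congr_ae (Eventually.of_forall split),
    integral_add (jG.const_mul (κ * 2)) (jP.const_mul 4), integral_const_mul, integral_const_mul]
  ring

end PairEnergy

/-! ### The trial state and non-criticality of the product state. -/

section TrialState

open Filter Topology

variable {A : R3 → R3} {V : R3 → ℝ} {φ : R3 → ℂ} {h : R3 → ℝ}

/-- If the first variation of the Pekar-Tomasevich energy at `φ ⊗ φ` in the direction
`h(x₁ - x₂) φ ⊗ φ` does not vanish, then the energy with `U = 2` drops strictly below twice the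
Pekar energy. -/
lemma IsPekarMinimizer.exists_pekarTomasevich_two_lt
    (hA : ∀ j : Fin 3, L2Loc (fun x => A x j))
    (hV : L2Loc V) (hVs : InfinitesimallySmall V) (hφ : IsPekarMinimizer A V φ)
    (hh : ContDiff ℝ ∞ h) (hs : HasCompactSupport h) (heven : ∀ x, h (-x) = h x)
    (hvar : 2 * (∫ p : R3 × R3, smear h φ p.1 * coulombDensity φ p)
      < (∫ p, relFun h p * coulombDensity φ p)
        + (∫ p, coulombDensity φ p) * ∫ p, relFun h p * ‖productState φ p‖ ^ 2) :
    ∃ ψ ∈ H1Pair A, ∫ p, ‖ψ p‖ ^ 2 = 1 ∧ pekarTomasevich A V 2 ψ < 2 * pekar A V φ := by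
  have hH := hφ.1.1
  have hφ1 := hφ.1.2
  choose g hg using hH.2
  have hn := integrable_norm_sq_of_memLp_two hH.1
  have hVn := integrable_potential_mul_norm_sq hA hV hVs hH
  have hk : Integrable (coulombDensity φ) volume := integrable_coulomb hA hH
  obtain ⟨C, hC⟩ := hh.continuous.bounded_above_of_compact_support hs
  have hC' : ∀ j, ∃ C', ∀ x, ‖fderiv ℝ h x (e j)‖ ≤ C' := fun j =>
    (continuous_fderiv_apply_of_contDiff hh (e j)).bounded_above_of_compact_support
      (hasCompactSupport_fderiv_apply hs (e j))
  choose C' hC' using hC'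
  have hrel := contDiff_relFun hh
  have hrelm : AEStronglyMeasurable (relFun h) volume := hrel.continuous.aestronglyMeasurable
  have hCrel : ∀ p, |relFun h p| ≤ C := fun p => hC (p.1 - p.2)
  have hC'rel : ∀ j p, |fderiv ℝ (relFun h) p (e j, 0)| ≤ C' j := fun j p => by
    rw [fderiv_relFun hh]; exact hC' j _
  have hprod := memLp_productState hH.1
  have hVp : Integrable (fun p : R3 × R3 => V p.1 * ‖productState φ p‖ ^ 2) volume := by
    have := hVn.mul_prod hn
    refine this.congr (Eventually.of_forall fun p => ?_)
    simp only [norm_sq_productState]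
    ring
  have hgt : ∀ j, HasMagneticDeriv (e j, (0 : R3)) (fun x : R3 × R3 => A x.1 j) (productState φ)
      (fun p => g j p.1 * φ p.2) := fun j => (hg j).tensor (hA j) hH.1 hH.1
  obtain ⟨K₂, hK⟩ := exists_integral_perturb_energy_eq hprod (fun j => (hgt j).1) hVp hrelm hCrel
    (fun j => (continuous_fderiv_apply_of_contDiff hrel (e j, 0)).aestronglyMeasurable) hC'rel
  have hEL := hφ.integral_energyVariation_relFun hA hV hVs hg hh hC hC'
  have hK0 : ∫ p : R3 × R3, ((∑ j, ‖g j p.1 * φ p.2‖ ^ 2) + V p.1 * ‖productState φ p‖ ^ 2)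
      = oneBodyEnergy V φ g := by
    have : ∀ p : R3 × R3, (∑ j, ‖g j p.1 * φ p.2‖ ^ 2) + V p.1 * ‖productState φ p‖ ^ 2
        = ((∑ j, ‖g j p.1‖ ^ 2) + V p.1 * ‖φ p.1‖ ^ 2) * ‖φ p.2‖ ^ 2 := fun p => by
      simp only [norm_sq_productState, norm_mul, mul_pow, ← Finset.sum_mul]
      ring
    simp only [this]
    rw [Measure.volume_eq_prod, integral_prod_mul
      (fun x => (∑ j, ‖g j x‖ ^ 2) + V x * ‖φ x‖ ^ 2) (fun x => ‖φ x‖ ^ 2), hφ1, mul_one]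
    rfl
  have hN := integral_one_add_sq_mul (integrable_norm_sq_of_memLp_two hprod) hrelm hCrel
  rw [integral_norm_sq_productState hφ1] at hN
  have hU := integral_one_add_sq_mul hk hrelm hCrel
  have hsq : ∀ x, |h x ^ 2| ≤ C ^ 2 := fun x => by
    rw [abs_pow]; exact pow_le_pow_left₀ (abs_nonneg _) (hC x) 2
  have hsm1 : ∀ x, |2 * smear h φ x| ≤ 2 * C := fun x => by
    rw [abs_mul, abs_two]; gcongr; exact abs_smear_le hC hH.1 hφ1 x
  obtain ⟨C₂, C₃, C₄, hc⟩ := exists_integral_kernel_eq hk (coulombDensity_swap φ)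
    (a := fun x => 2 * smear h φ x) (b := smear (fun z => h z ^ 2) φ)
    ((aestronglyMeasurable_smear hh.continuous hH.1).const_mul 2) hsm1
    (aestronglyMeasurable_smear (hh.continuous.pow 2) hH.1) (abs_smear_le hsq hH.1 hφ1)
  have hcoul : ∀ c t : ℝ, coulomb (pairDensity (perturb c t (relFun h) (productState φ)))
      = 4 * c ^ 4 * ∫ p : R3 × R3, (1 + t * (2 * smear h φ p.1)
            + t ^ 2 * smear (fun z => h z ^ 2) φ p.1)
          * (1 + t * (2 * smear h φ p.2) + t ^ 2 * smear (fun z => h z ^ 2) φ p.2)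
          * coulombDensity φ p := by
    intro c t
    rw [coulomb, ← integral_const_mul]
    congr 1; ext p
    simp only [pairDensity_perturb hh.continuous hC heven hH.1 hφ1, coulombDensity]
    ring
  have hrep : ∀ c t : ℝ, ∫ p : R3 × R3,
      ‖perturb c t (relFun h) (productState φ) p‖ ^ 2 / ‖p.1 - p.2‖
      = c ^ 2 * ∫ p, (1 + t * relFun h p) ^ 2 * coulombDensity φ p := by
    intro c t
    rw [← integral_const_mul]
    congr 1; ext p
    rw [norm_sq_perturb, norm_sq_productState, coulombDensity]
    ring
  have hder := fun j (c t : ℝ) =>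
    (hgt j).perturb (memLp_restrict_comp_fst (hA j)) hprod hrel hCrel (hC'rel j) c t
  -- If no state lies lower, t = 0 is a minimum along the curve of normalized perturbations. The
  -- first-order condition, after the Euler-Lagrange equation is inserted, makes `hvar` an equality.
  by_contra! hcon
  -- The repulsion is quadratic in the state and joins the one-body terms, since it scales with c²
  -- as well. The factors 4 come from the density 2|φ|² at t = 0.
  have hfirst := first_variation_eq (K₀ := 2 * oneBodyEnergy V φ g + 2 * ∫ p, coulombDensity φ p)
    (K₁ := 2 * (∫ p, energyVariation (relFun h) (fun j p => fderiv ℝ (relFun h) p (e j, 0))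
        (fun p : R3 × R3 => V p.1) (productState φ) (fun j p => g j p.1 * φ p.2) p)
      + 2 * (2 * ∫ p, relFun h p * coulombDensity φ p))
    (K₂ := 2 * K₂ + 2 * ∫ p, relFun h p ^ 2 * coulombDensity φ p)
    (N₁ := 2 * ∫ p, relFun h p * ‖productState φ p‖ ^ 2)
    (N₂ := ∫ p, relFun h p ^ 2 * ‖productState φ p‖ ^ 2)
    (C₀ := 4 * ∫ p, coulombDensity φ p)
    (C₁ := 4 * (2 * ∫ p : R3 × R3, 2 * smear h φ p.1 * coulombDensity φ p))
    (C₂ := 4 * C₂) (C₃ := 4 * C₃) (C₄ := 4 * C₄) ?_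
  · have e2 : ∫ p : R3 × R3, 2 * smear h φ p.1 * coulombDensity φ p
        = 2 * ∫ p : R3 × R3, smear h φ p.1 * coulombDensity φ p := by
      simp only [mul_assoc, integral_const_mul]
    rw [hEL, e2] at hfirst
    linarith
  intro t ht
  have hNt := hN t
  set N := 1 + t * (2 * ∫ p, relFun h p * ‖productState φ p‖ ^ 2)
    + t ^ 2 * ∫ p, relFun h p ^ 2 * ‖productState φ p‖ ^ 2
  obtain ⟨c, hc2⟩ : ∃ c : ℝ, c ^ 2 = N⁻¹ := ⟨(√N)⁻¹, by rw [inv_pow, Real.sq_sqrt ht.le]⟩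
  have hc4 : c ^ 4 = (N ^ 2)⁻¹ := by
    rw [show c ^ 4 = (c ^ 2) ^ 2 by ring, hc2, inv_pow]
  have hsymm := perturb_productState_swap (φ := φ) heven c t
  have hmem : perturb c t (relFun h) (productState φ) ∈ H1Pair A := by
    refine ⟨memLp_perturb hprod hrelm hCrel c t, fun j => ⟨_, hder j c t⟩, fun j => ?_⟩
    have := HasMagneticDeriv.swap (a := fun x => A x j) (hder j c t)
    simp only [hsymm] at this
    exact ⟨_, this⟩
  have hone : ∫ p, ‖perturb c t (relFun h) (productState φ) p‖ ^ 2 = 1 := by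
    simp only [norm_sq_perturb]
    rw [integral_const_mul, hNt, hc2, inv_mul_cancel₀ ht.ne']
  have hle := hcon _ hmem hone
  rw [pekarTomasevich_eq_of_symm hsymm fun j => hder j c t, hK, hK0, hrep, hU, hcoul, hc, hc2, hc4,
    pekar_eq hg, coulomb_norm_sq] at hle
  rw [div_eq_inv_mul, div_eq_inv_mul]
  linarith

/-- A set of positive measure contains a point all of whose neighbourhoods meet it in positive
measure. -/
lemma exists_pos_integral_ball {n : R3 → ℝ} (hn : Integrable n volume) (h0 : ∀ x, 0 ≤ n x)
    (hpos : 0 < ∫ x, n x) {r : ℝ} (hr : 0 < r) : ∃ z, 0 < ∫ x in Metric.ball z r, n x := by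
  have hsupp : 0 < volume (Function.support n) :=
    (integral_pos_iff_support_of_nonneg h0 hn).1 hpos
  obtain ⟨z, -, hz⟩ := exists_mem_forall_mem_nhdsWithin_pos_measure hsupp.ne'
  refine ⟨z, ?_⟩
  rw [setIntegral_pos_iff_support_of_nonneg_ae (Eventually.of_forall h0) hn.integrableOn]
  exact hz _ (inter_mem_nhdsWithin _ (Metric.ball_mem_nhds z hr))

/-- On the diagonal the quotient by ‖x - y‖ takes the default value 0, so the lower bound on the
Coulomb kernel holds only off this null set. -/
lemma ae_fst_ne_snd : ∀ᵐ p : R3 × R3, p.1 ≠ p.2 := by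
  have hm : MeasurableSet {p : R3 × R3 | p.1 = p.2} := isClosed_diagonal.measurableSet
  rw [ae_iff, Measure.volume_eq_prod]
  simp only [not_not]
  rw [Measure.measure_prod_null hm]
  refine Eventually.of_forall fun x => ?_
  have : Prod.mk x ⁻¹' {p : R3 × R3 | p.1 = p.2} = {x} := by
    ext y; simp [eq_comm]
  simp [this]

/-- Localization at the diagonal makes the first variation nonzero. -/
lemma exists_even_bump_variation_pos (hA : ∀ j : Fin 3, L2Loc (fun x => A x j))
    (hH : φ ∈ H1 A) (hφ1 : ∫ x, ‖φ x‖ ^ 2 = 1) :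
    ∃ h : R3 → ℝ, ContDiff ℝ ∞ h ∧ HasCompactSupport h ∧ (∀ x, h (-x) = h x) ∧
      2 * (∫ p : R3 × R3, smear h φ p.1 * coulombDensity φ p)
        < (∫ p, relFun h p * coulombDensity φ p)
          + (∫ p, coulombDensity φ p) * ∫ p, relFun h p * ‖productState φ p‖ ^ 2 := by
  obtain ⟨M, hM0, hM⟩ := exists_integral_coulomb_le hA hH
  have hn := integrable_norm_sq_of_memLp_two hH.1
  have hk : Integrable (coulombDensity φ) volume := integrable_coulomb hA hH
  -- Within distance ε the Coulomb kernel is at least 2M + 1, off the diagonal. The correlated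
  -- integral then gains (2M + 1) G, more than the 2M G that the mean-field term can cost.
  set ε : ℝ := 1 / (2 * M + 1)
  have hε : 0 < ε := by positivity
  let b : ContDiffBump (0 : R3) := ⟨ε / 2, ε, by positivity, by linarith⟩
  have hb : ContDiff ℝ ∞ b := b.contDiff
  have hb1 : ∀ x, |b x| ≤ 1 := fun x => by rw [abs_of_nonneg b.nonneg]; exact b.le_one
  have hrelm : AEStronglyMeasurable (relFun b) volume :=
    (contDiff_relFun hb).continuous.aestronglyMeasurable
  have iG : Integrable (fun p => relFun b p * ‖productState φ p‖ ^ 2) volume :=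
    integrable_bdd_mul (integrable_norm_sq_of_memLp_two (memLp_productState hH.1)) hrelm
      (fun p => hb1 _)
  have iH : Integrable (fun p => relFun b p * coulombDensity φ p) volume :=
    integrable_bdd_mul hk hrelm (fun p => hb1 _)
  have hrel0 : ∀ p, 0 ≤ relFun b p := fun p => b.nonneg
  refine ⟨b, hb, b.hasCompactSupport, b.neg, ?_⟩
  set G := ∫ p, relFun b p * ‖productState φ p‖ ^ 2
  have hG : 0 < G := by
    -- Two points of a ball of radius ε/4 are closer than ε/2, the inner radius of the bump, so the
    -- bump equals 1 on such pairs.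
    obtain ⟨z, hz⟩ := exists_pos_integral_ball hn (fun x => by positivity)
      (by rw [hφ1]; exact one_pos) (show 0 < ε / 4 by positivity)
    set B := Metric.ball z (ε / 4)
    have hB : MeasurableSet (B ×ˢ B) :=
      Metric.isOpen_ball.measurableSet.prod Metric.isOpen_ball.measurableSet
    calc 0 < (∫ x in B, ‖φ x‖ ^ 2) * ∫ x in B, ‖φ x‖ ^ 2 := mul_pos hz hz
      _ = ∫ p in B ×ˢ B, ‖φ p.1‖ ^ 2 * ‖φ p.2‖ ^ 2 := by
        rw [Measure.volume_eq_prod, setIntegral_prod_mul (fun x => ‖φ x‖ ^ 2) (fun x => ‖φ x‖ ^ 2)]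
      _ = ∫ p in B ×ˢ B, relFun b p * ‖productState φ p‖ ^ 2 := by
        refine setIntegral_congr_fun hB fun p hp => ?_
        have h1 : relFun b p = 1 := b.one_of_mem_closedBall (by
          have h1 := Metric.mem_ball.1 hp.1
          have h2 := Metric.mem_ball.1 hp.2
          have h3 := dist_triangle_right p.1 p.2 z
          rw [mem_closedBall_zero_iff, ← dist_eq_norm]
          change dist p.1 p.2 ≤ ε / 2
          linarith)
        simp only [h1, one_mul, norm_sq_productState]
      _ ≤ G := setIntegral_le_integral iG (Eventually.of_forall fun p =>
          mul_nonneg (hrel0 p) (by positivity))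
  have hC0 : 0 ≤ ∫ p, coulombDensity φ p := integral_nonneg fun p => by
    simp only [coulombDensity]; positivity
  have hHG : (2 * M + 1) * G ≤ ∫ p, relFun b p * coulombDensity φ p := by
    rw [← integral_const_mul]
    refine integral_mono_ae (iG.const_mul _) iH ?_
    filter_upwards [ae_fst_ne_snd] with p hp
    by_cases hpb : ‖p.1 - p.2‖ < ε
    · have hd : 0 < ‖p.1 - p.2‖ := norm_pos_iff.2 (sub_ne_zero.2 hp)
      have h1 : 2 * M + 1 ≤ 1 / ‖p.1 - p.2‖ := by
        rw [le_div_iff₀ hd]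
        have := mul_le_mul_of_nonneg_left hpb.le (show 0 ≤ 2 * M + 1 by positivity)
        refine this.trans (le_of_eq ?_)
        simp only [ε]
        field_simp
      have h2 : 0 ≤ relFun b p * ‖productState φ p‖ ^ 2 :=
        mul_nonneg (hrel0 p) (by positivity)
      calc (2 * M + 1) * (relFun b p * ‖productState φ p‖ ^ 2)
          ≤ 1 / ‖p.1 - p.2‖ * (relFun b p * ‖productState φ p‖ ^ 2) := by gcongr
        _ = relFun b p * coulombDensity φ p := by
          rw [norm_sq_productState, coulombDensity]; ring
    · have h0 : relFun b p = 0 := by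
        have : p.1 - p.2 ∉ Function.support b := by
          rw [b.support_eq, mem_ball_zero_iff]
          exact hpb
        exact Function.notMem_support.1 this
      simp [h0]
  -- Integrating the second variable first leaves the Coulomb potential of |φ|², bounded by M, and
  -- what remains is G by Fubini.
  have hPG : ∫ p : R3 × R3, smear b φ p.1 * coulombDensity φ p ≤ M * G := by
    have hsm0 : ∀ x, 0 ≤ smear b φ x := fun x =>
      integral_nonneg fun y => mul_nonneg b.nonneg (by positivity)
    have hsmm := aestronglyMeasurable_smear hb.continuous hH.1
    have iP : Integrable (fun p : R3 × R3 => smear b φ p.1 * coulombDensity φ p) volume :=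
      integrable_bdd_mul hk hsmm.comp_fst (fun p => abs_smear_le hb1 hH.1 hφ1 p.1)
    have eG : G = ∫ x, smear b φ x * ‖φ x‖ ^ 2 := by
      simp only [G]
      rw [Measure.volume_eq_prod, integral_prod _ iG]
      congr 1; ext x
      rw [smear, ← integral_mul_const]
      congr 1; ext y
      rw [norm_sq_productState, relFun]; ring
    have eP : ∀ x y, smear b φ x * coulombDensity φ (x, y)
        = smear b φ x * ‖φ x‖ ^ 2 * (‖φ y‖ ^ 2 / ‖y - x‖) := fun x y => by
      rw [coulombDensity, norm_sub_rev]; ring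
    have iS : Integrable (fun x => smear b φ x * ‖φ x‖ ^ 2) volume :=
      integrable_bdd_mul hn hsmm (abs_smear_le hb1 hH.1 hφ1)
    rw [Measure.volume_eq_prod] at iP ⊢
    rw [integral_prod _ iP, eG, ← integral_const_mul]
    refine integral_mono iP.integral_prod_left (iS.const_mul M) fun x => ?_
    simp only [eP, integral_const_mul]
    rw [mul_comm M]
    exact mul_le_mul_of_nonneg_left (hM x).2 (mul_nonneg (hsm0 x) (by positivity))
  have := mul_nonneg hC0 hG.le
  nlinarith

end TrialState

end Polaron

/-! ### From U = 2 to slightly larger U. -/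

theorem theorem3p1 (A : Polaron.R3 → Polaron.R3) (V : Polaron.R3 → ℝ)
    (hA : ∀ j : Fin 3, Polaron.L2Loc (fun x => A x j))
    (hV : Polaron.L2Loc V)
    (hVsmall : Polaron.InfinitesimallySmall V)
    (hmin : ∃ φ₀ : Polaron.R3 → ℂ, Polaron.IsPekarMinimizer A V φ₀) :
    ∃ UA : ℝ, 2 < UA ∧ ∀ U : ℝ, 2 < U → U < UA →
      Polaron.pairEnergy A V U < 2 * Polaron.pekarEnergy A V 1 := by
  obtain ⟨φ, hφ⟩ := hmin
  obtain ⟨h, hh, hs, heven, hvar⟩ :=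
    Polaron.exists_even_bump_variation_pos hA hφ.1.1 hφ.1.2
  obtain ⟨ψ, hψ, hψ1, hlt⟩ :=
    hφ.exists_pekarTomasevich_two_lt hA hV hVsmall hh hs heven hvar
  set R : ℝ := ∫ p : Polaron.R3 × Polaron.R3, ‖ψ p‖ ^ 2 / ‖p.1 - p.2‖ with hR
  have hR0 : 0 ≤ R := integral_nonneg fun p => by positivity
  set gap := 2 * Polaron.pekar A V φ - Polaron.pekarTomasevich A V 2 ψ
  have hgap : 0 < gap := sub_pos.2 hlt
  -- For the fixed ψ the energy is affine in U with slope R, so the gap at U = 2 survives while (U -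
  -- 2) R < gap; R + 1 avoids a vanishing denominator.
  refine ⟨2 + gap / (R + 1), lt_add_of_pos_right _ (by positivity), fun U hU hUA => ?_⟩
  have hE : Polaron.pekarTomasevich A V U ψ
      = Polaron.pekarTomasevich A V 2 ψ + (U - 2) * R := by
    simp only [Polaron.pekarTomasevich, hR]
    ring
  have hlt' : Polaron.pekarTomasevich A V U ψ < 2 * Polaron.pekar A V φ := by
    have h1 : (U - 2) * (R + 1) < gap := by
      rw [← lt_div_iff₀ (by positivity)]
      linarith
    have h2 : (U - 2) * R ≤ (U - 2) * (R + 1) :=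
      mul_le_mul_of_nonneg_left (by linarith) (by linarith)
    rw [hE]
    simp only [gap] at h1
    linarith
  have hpek : Polaron.pekarEnergy A V 1 = (Polaron.pekar A V φ : EReal) :=
    le_antisymm (iInf₂_le φ hφ.1)
      (le_iInf₂ fun χ hχ => EReal.coe_le_coe_iff.2 (isMinOn_iff.1 hφ.2 χ hχ))
  calc Polaron.pairEnergy A V U ≤ (Polaron.pekarTomasevich A V U ψ : EReal) :=
        iInf₂_le ψ ⟨hψ, hψ1⟩
    _ < ((2 * Polaron.pekar A V φ : ℝ) : EReal) := EReal.coe_lt_coe_iff.2 hlt'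
    _ = 2 * Polaron.pekarEnergy A V 1 := by
        rw [hpek, EReal.coe_mul]
        rfl
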